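/- \textbf{Game.} There are $K\ge 2$ experts $e_1,\dots,e_K$ and $T\ge 1$ rounds. In round $t$ a nonempty set $E_a^t$ of experts is alive, with $E_a^1=\{e_1,\dots,e_K\}$ and $E_a^{t+1}\subseteq E_a^t$. The learner plays a probability vector $p_t$ supported on $E_a^t$, losses $\ell_{i,t}\in[0,1]$ are revealed, and the learner suffers $\hat\ell_t=\sum_i p_{i,t}\ell_{i,t}$. An ordering $\pi$ of the experts plays in round $t$ its first alive expert $\sigma^t(\pi)$, and its loss in that round is that of $\sigma^t(\pi)$. Let $\Pi$ be the set of all orderings. For a set $A$ of orderings let $L^\pi_n=\sum_{t\le n}\ell_{\sigma^t(\pi),t}$, $L^*_n=\min_{\pi\in A}L^\pi_n$, and $R_A(1,n)=\sum_{t\le n}\hat\ell_t-L^*_n$. If several experts die on one night, their deaths are processed one at a time (in order of index), separated by dummy rounds without loss, which are not counted as rounds. A set $\mathcal E$ of effective orderings contains exactly one ordering of each behavior, where two orderings have the same behavior if they play the same expert in every round (dummy rounds included). \textbf{FlipFlop.} Hedge over $A$ with learning rate $\eta\in(0,\infty)$ gives $\pi$ in round $t$ a weight $e^{-\eta L^\pi_{t-1}}$;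 with $\eta=\infty$ (Follow the Leader, FTL) it gives weight $1$ to each $\pi\in A$ with $L^\pi_{t-1}=L^*_{t-1}$ and $0$ to the others; the normalized weights $w_t$ are played. Its mix loss is $m_t=-\frac1\eta\ln\sum_{\pi\in A} w_t(\pi)e^{-\eta\ell_{\sigma^t(\pi),t}}$, and $m_t=L^*_t-L^*_{t-1}$ if $\eta=\infty$. FlipFlop with parameters $\alpha>0$, $\varphi>1$ starts in the flip regime with $\Delta^{\mathrm{flip}}=\Delta^{\mathrm{flop}}=0$. It uses $\eta_t=\infty$ in the flip regime and the AdaHedge rate $\eta_t=\ln|A|/\Delta^{\mathrm{flop}}$ in the flop regime ($\infty$ if $\Delta^{\mathrm{flop}}=0$); after each round it adds $\hat\ell_t-m_t$ to the $\Delta$ of the current regime, and then changes from flip to flop if $\Delta^{\mathrm{flip}}>\frac{\varphi}{\alpha}\Delta^{\mathrm{flop}}$, from flop to flip if $\Delta^{\mathrm{flop}}>\alpha\Delta^{\mathrm{flip}}$. \textbf{Algorithms.} For a finite $\eta$, the algorithm keeps numbers $h_i,c_i$ for each expert, initially $c_i=1$ and $h_i=h_{i,1}$. When losses arrive, $c_i\leftarrow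 c_ie^{-\eta\ell_{i,t}}$; when $e_j$ dies, $h_i\leftarrow h_ic_i+h_jc_js_{ij}$ and then $c_i\leftarrow1$ for every remaining expert $e_i$. The weight of $e_i$ is $h_ic_i$. Hedge-Perm-Unknown (HPU) has $h_{i,1}=(K-1)!$, and $s_{ij}=1/r$ where $r$ is the number of remaining experts. Hedge-Perm-Known (HPK) is used when the experts die in the order $e_1,e_2,\dots,e_m$, $m$ being the number of experts that die during the $T$ rounds; it has $h_{i,1}=2^{m-i}(K-m)$ for $i\le m$, $h_{i,1}=1$ for $i>m$, and $s_{ij}=h_{i,1}/h_{j,1}$. For $\eta=\infty$ the algorithm keeps for each expert a loss $L_i$ (initially $0$) and a multiplicity $n_i$ (initially $h_{i,1}$). When losses arrive, $L_i\leftarrow L_i+\ell_{i,t}$; when $e_j$ dies, for each remaining $e_i$: if $L_i>L_j$ then $L_i\leftarrow L_j$ and $n_i\leftarrow n_js_{ij}$; if $L_i=L_j$ then $n_i\leftarrow n_i+n_js_{ij}$. The weight of $e_i$ is $n_i$ if $L_i$ is minimal among the alive experts, and $0$ otherwise. In either case the algorithm plays the normalized weights of the alive experts. Its mix loss is $-\frac1\eta\ln\sum_i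 p_{i,t}e^{-\eta\ell_{i,t}}$, or, for $\eta=\infty$, the increase in round $t$ of the minimum of $L_i$ over alive experts. The extended HPU and HPK choose in round $t$ the rate $\eta_t$ by the above rules of FlipFlop, applied to their own losses and mix losses, with $\sum_ih_{i,1}$ in place of $|A|$, and use the weights of round $t$ for $\eta=\eta_t$. \textbf{Claim.} For all $\alpha>0$, $\varphi>1$ there are positive constants $C_0,C_1,C_2,C_3$ such that for all $K\ge2$, $T\ge1$ and every game as above the following holds for the extended HPU with $A=\Pi$ and, if the experts die in the order of their indices, for the extended HPK with $A=\mathcal E$, for any set $\mathcal E$ of effective orderings. (i) The algorithm simulates FlipFlop over $A$: in every round $t\le T$ it has the same $\Delta^{\mathrm{flip}}$, $\Delta^{\mathrm{flop}}$, regime and learning rate; the weight of each alive expert $e_i$ is the sum of the weights of the $\pi\in A$ with $\sigma^t(\pi)=e_i$; $p_{i,t}$ is the probability that FlipFlop over $A$ gives to the orderings $\pi\in A$ with $\sigma^t(\pi)=e_i$; and the minimum of $L_i$ over alive experts is $L^*_{t-1}$ before and $L^*_t$ after the losses of round $t$. (ii) For every $n$ with $1\le n\le T$, in particular for $n=T$,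 $$R_A(1,n)<\min\left\{C_0R_A^{\mathrm{ftl}}(1,n)+C_1,\ C_2\sqrt{\frac{L^*_n(n-L^*_n)}{n}\ln|A|}+C_3\ln|A|\right\},$$ where $R_A^{\mathrm{ftl}}(1,n)$ is the regret of FTL over $A$ on the same losses. -/

import Mathlib

namespace DyingExperts

noncomputable section

/-- The minimum of `f` over a finite set (`0` if the set is empty, which never matters below). -/
def finMin {X : Type*} (s : Finset X) (f : X → ℝ) : ℝ :=
  if h : s.Nonempty then s.inf' h f else 0

/- Hedge, Follow the Leader and FlipFlop over an arbitrary finite set `A` of experts,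
whose losses in round `t = 1, 2, …` are `loss t`. A learning rate is an element of `(0, ∞]`;
the rate `⊤` is Follow the Leader. -/

/-- Cumulative loss of expert `x` after `n` rounds. -/
def cumLoss {X : Type*} (loss : ℕ → X → ℝ) (n : ℕ) (x : X) : ℝ :=
  ∑ s ∈ Finset.Icc 1 n, loss s x

/-- `L*_n`, the cumulative loss of the best expert of `A` after `n` rounds. -/
def bestLoss {X : Type*} (A : Finset X) (loss : ℕ → X → ℝ) (n : ℕ) : ℝ :=
  finMin A (cumLoss loss n)

/-- Non-normalized weight that Hedge with rate `η` gives to expert `x` after `n` rounds, that is,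
in round `n + 1`. With rate `⊤` it is the indicator of the current leaders. -/
def hedgeWeight {X : Type*} (A : Finset X) (loss : ℕ → X → ℝ) (n : ℕ) (η : WithTop ℝ) (x : X) :
    ℝ :=
  match η with
  | ⊤ => if cumLoss loss n x = bestLoss A loss n then 1 else 0
  | (η : ℝ) => Real.exp (-η * cumLoss loss n x)

/-- Probability that Hedge with rate `η` gives to expert `x` of `A` in round `n + 1`. -/
def hedgeProb {X : Type*} (A : Finset X) (loss : ℕ → X → ℝ) (n : ℕ) (η : WithTop ℝ) (x : X) : ℝ :=
  hedgeWeight A loss n η x / ∑ y ∈ A, hedgeWeight A loss n η y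

/-- Loss of Hedge with rate `η` in round `n + 1`. -/
def hedgeLoss {X : Type*} (A : Finset X) (loss : ℕ → X → ℝ) (n : ℕ) (η : WithTop ℝ) : ℝ :=
  ∑ x ∈ A, hedgeProb A loss n η x * loss (n + 1) x

/-- Mix loss of Hedge with rate `η` in round `n + 1`:
`-(1/η) ln (w · e^{-η ℓ})`, and `L*_{n+1} - L*_n` for the rate `⊤`. -/
def hedgeMixLoss {X : Type*} (A : Finset X) (loss : ℕ → X → ℝ) (n : ℕ) (η : WithTop ℝ) : ℝ :=
  match η with
  | ⊤ => bestLoss A loss (n + 1) - bestLoss A loss n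
  | (η : ℝ) =>
      -(1 / η) * Real.log (∑ x ∈ A, hedgeProb A loss n (η : WithTop ℝ) x *
        Real.exp (-η * loss (n + 1) x))

/-- The bookkeeping of FlipFlop: the cumulative mixability gaps of the Follow-the-Leader (flip)
rounds and of the AdaHedge (flop) rounds, and whether the current regime is flop. -/
structure FFState where
  dFlip : ℝ
  dFlop : ℝ
  inFlop : Bool

/-- FlipFlop starts in the flip regime, with both gaps zero. -/
def FFState.start : FFState := ⟨0, 0, false⟩

/-- The learning rate on `N` experts: `∞` in the flip regime and `(ln N) / Δ^flop` in the flop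
regime (`∞` as long as `Δ^flop = 0`). -/
def FFState.rate (N : ℝ) (s : FFState) : WithTop ℝ :=
  if s.inFlop = true ∧ s.dFlop ≠ 0 then ((Real.log N / s.dFlop : ℝ) : WithTop ℝ) else ⊤

/-- Account for the mixability gap `δ` of a round, and switch from flip to flop as soon as
`Δ^flip > (φ/α) Δ^flop`, from flop to flip as soon as `Δ^flop > α Δ^flip`. -/
def FFState.update (α φ δ : ℝ) (s : FFState) : FFState :=
  if s.inFlop = true then
    ⟨s.dFlip, s.dFlop + δ, if s.dFlop + δ > α * s.dFlip then false else true⟩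
  else
    ⟨s.dFlip + δ, s.dFlop, if s.dFlip + δ > φ / α * s.dFlop then true else false⟩

/-- The bookkeeping of FlipFlop over `A` after `n` rounds. -/
def flipFlop {X : Type*} (α φ : ℝ) (A : Finset X) (loss : ℕ → X → ℝ) : ℕ → FFState
  | 0 => FFState.start
  | n + 1 =>
      let s := flipFlop α φ A loss n
      let η := s.rate (A.card : ℝ)
      s.update α φ (hedgeLoss A loss n η - hedgeMixLoss A loss n η)

/-- The learning rate of FlipFlop over `A` in round `n + 1`. -/
def flipFlopRate {X : Type*} (α φ : ℝ) (A : Finset X) (loss : ℕ → X → ℝ) (n : ℕ) : WithTop ℝ :=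
  (flipFlop α φ A loss n).rate (A.card : ℝ)

/-- Regret of Follow the Leader over `A` after `n` rounds. -/
def ftlRegret {X : Type*} (A : Finset X) (loss : ℕ → X → ℝ) (n : ℕ) : ℝ :=
  ∑ k ∈ Finset.range n, hedgeLoss A loss k ⊤ - bestLoss A loss n

/- The dying experts game. -/

/-- Nature's choices in a game of `T` rounds on `K` experts. Round numbers start at `1`. -/
structure Game (K T : ℕ) where
  /-- `loss t i` is the loss of expert `i` in round `t`. -/
  loss : ℕ → Fin K → ℝ
  /-- `alive t` is the set of experts that are available in round `t`. -/
  alive : ℕ → Finset (Fin K)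
  loss_mem : ∀ t, 1 ≤ t → t ≤ T → ∀ i, loss t i ∈ Set.Icc (0 : ℝ) 1
  alive_one : alive 1 = Finset.univ
  alive_anti : ∀ t, 1 ≤ t → t < T → alive (t + 1) ⊆ alive t
  alive_nonempty : ∀ t, 1 ≤ t → t ≤ T → (alive t).Nonempty

/-- An ordering of the experts: `π k` is the expert in position `k`. -/
abbrev PermExpert (K : ℕ) : Type := Equiv.Perm (Fin K)

/-- The first expert of the ordering `π` that belongs to `S` (for nonempty `S`). -/
def firstAlive {K : ℕ} [NeZero K] (S : Finset (Fin K)) (π : PermExpert K) : Fin K :=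
  if h : (Finset.univ.filter fun k => π k ∈ S).Nonempty then
    π ((Finset.univ.filter fun k => π k ∈ S).min' h)
  else 0

/-- `σ^t(π)`, the expert played by the ordering `π` in round `t`. -/
def Game.sigma {K T : ℕ} [NeZero K] (G : Game K T) (t : ℕ) (π : PermExpert K) : Fin K :=
  firstAlive (G.alive t) π

/-- The losses of the orderings. -/
def Game.permLoss {K T : ℕ} [NeZero K] (G : Game K T) (t : ℕ) (π : PermExpert K) : ℝ :=
  G.loss t (G.sigma t π)

/-- The experts that die on night `t`, in the order in which they are processed. If there are
several, they are processed one after the other, separated by dummy rounds. -/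
def Game.deaths {K T : ℕ} (G : Game K T) (t : ℕ) : List (Fin K) :=
  (G.alive t \ G.alive (t + 1)).sort (· ≤ ·)

/-- Two orderings behave in the same way if they play the same expert in every round, including
the dummy rounds between the deaths of one night (there are none if at most one expert dies per
night). -/
def Game.SameBehavior {K T : ℕ} [NeZero K] (G : Game K T) (π ρ : PermExpert K) : Prop :=
  (∀ t, 1 ≤ t → t ≤ T → G.sigma t π = G.sigma t ρ) ∧
  (∀ t, 1 ≤ t → t < T → ∀ k, 1 ≤ k → k < (G.deaths t).length →
    firstAlive (G.alive t \ ((G.deaths t).take k).toFinset) π =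
      firstAlive (G.alive t \ ((G.deaths t).take k).toFinset) ρ)

/-- `A` is a set of effective orderings: it contains exactly one ordering of each behavior. -/
def Game.IsEffective {K T : ℕ} [NeZero K] (G : Game K T) (A : Finset (PermExpert K)) : Prop :=
  ∀ π : PermExpert K, ∃! ρ : PermExpert K, ρ ∈ A ∧ G.SameBehavior π ρ

/-- The experts die in the order of their indices. -/
def Game.DiesInOrder {K T : ℕ} (G : Game K T) : Prop :=
  ∀ t, 1 ≤ t → t ≤ T → ∀ i j, i < j → i ∈ G.alive t → j ∈ G.alive t

/-- The number of experts that die during the game. -/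
def Game.numDeaths {K T : ℕ} (G : Game K T) : ℕ := K - (G.alive T).card

/- Hedge-Perm-Unknown and Hedge-Perm-Known. They differ only in the initial coefficients and in the
fractions of the weight of a dead expert that the remaining experts receive. -/

/-- `init i` is the initial coefficient `h_{i,1}`; `share E j i` is the fraction of the weight of
the dying expert `j` that goes to expert `i`, where `E` is the set of the remaining experts. -/
structure Rule (K : ℕ) where
  init : Fin K → ℝ
  share : Finset (Fin K) → Fin K → Fin K → ℝ

/-- Hedge-Perm-Unknown. -/
def hpu (K : ℕ) : Rule K where
  init _ := ((K - 1).factorial : ℝ)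
  share E _ _ := 1 / (E.card : ℝ)

/-- The number of effective orderings that start with expert `i` when the experts `0, …, m - 1`
(out of `0, …, K - 1`) die one at a time in this order. -/
def startCount (K m : ℕ) (i : Fin K) : ℕ :=
  if (i : ℕ) < m then 2 ^ (m - 1 - (i : ℕ)) * (K - m) else 1

/-- Hedge-Perm-Known. For `m = K - 1`, expert number `i` counted from `1` has
`init = ⌈2 ^ (K - i - 1)⌉` and `share = ⌈2 ^ (K - i - 1)⌉ / 2 ^ (K - j - 1)`. -/
def hpk (K m : ℕ) : Rule K where
  init i := (startCount K m i : ℝ)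
  share _ j i := (startCount K m i : ℝ) / (startCount K m j : ℝ)

/-- The variables of HPU / HPK with a finite learning rate. -/
structure HCState (K : ℕ) where
  alive : Finset (Fin K)
  h : Fin K → ℝ
  c : Fin K → ℝ

/-- The losses of a round are received. -/
def HCState.receive {K : ℕ} (η : ℝ) (l : Fin K → ℝ) (s : HCState K) : HCState K :=
  { s with c := fun i => s.c i * Real.exp (-η * l i) }

/-- Expert `j` dies. -/
def HCState.die {K : ℕ} (R : Rule K) (s : HCState K) (j : Fin K) : HCState K where
  alive := s.alive.erase j
  h i := if i ∈ s.alive.erase j then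
      s.h i * s.c i + s.h j * s.c j * R.share (s.alive.erase j) j i else s.h i
  c i := if i ∈ s.alive.erase j then 1 else s.c i

/-- The variables of HPU / HPK with learning rate `η` at the beginning of round `n + 1`. -/
def Game.hcRun {K T : ℕ} (G : Game K T) (R : Rule K) (η : ℝ) : ℕ → HCState K
  | 0 => ⟨Finset.univ, R.init, fun _ => 1⟩
  | n + 1 => (G.deaths (n + 1)).foldl (HCState.die R)
      ((G.hcRun R η n).receive η (G.loss (n + 1)))

/-- The variables of the implementation of Follow the Leader (HPU / HPK with learning rate `∞`):
`L i` is the cumulative loss kept for expert `i`, and `mult i` its multiplicity, that is, how many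
orderings that now play `i` attain it. -/
structure FTLState (K : ℕ) where
  alive : Finset (Fin K)
  L : Fin K → ℝ
  mult : Fin K → ℝ

/-- The losses of a round are received. -/
def FTLState.receive {K : ℕ} (l : Fin K → ℝ) (s : FTLState K) : FTLState K :=
  { s with L := fun i => s.L i + l i }

/-- Expert `j` dies: each remaining expert `i` with `L i > L j` gets `L i := L j`. -/
def FTLState.die {K : ℕ} (R : Rule K) (s : FTLState K) (j : Fin K) : FTLState K where
  alive := s.alive.erase j
  L i := if i ∈ s.alive.erase j ∧ s.L j < s.L i then s.L j else s.L i
  mult i := if i ∈ s.alive.erase j then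
      if s.L j < s.L i then s.mult j * R.share (s.alive.erase j) j i
      else if s.L j = s.L i then s.mult i + s.mult j * R.share (s.alive.erase j) j i
      else s.mult i
    else s.mult i

/-- The least cumulative loss kept for an alive expert. -/
def FTLState.best {K : ℕ} (s : FTLState K) : ℝ := finMin s.alive s.L

/-- The variables of the implementation of Follow the Leader at the beginning of round `n + 1`. -/
def Game.ftlRun {K T : ℕ} (G : Game K T) (R : Rule K) : ℕ → FTLState K
  | 0 => ⟨Finset.univ, fun _ => 0, R.init⟩
  | n + 1 => (G.deaths (n + 1)).foldl (FTLState.die R)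
      ((G.ftlRun R n).receive (G.loss (n + 1)))

/-- `L*_n` as it is known to the algorithm at the beginning of round `n + 1`. -/
def Game.algBest {K T : ℕ} (G : Game K T) (R : Rule K) (n : ℕ) : ℝ := (G.ftlRun R n).best

/-- `L*_{n+1}` as it is known to the algorithm after the losses of round `n + 1` are received. -/
def Game.algBestNext {K T : ℕ} (G : Game K T) (R : Rule K) (n : ℕ) : ℝ :=
  ((G.ftlRun R n).receive (G.loss (n + 1))).best

/-- The weight that the algorithm with learning rate `η` gives to the expert `i` in round `n + 1`.
With rate `⊤` only the alive experts of least cumulative loss `L i` have a positive weight. -/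
def Game.algWeight {K T : ℕ} (G : Game K T) (R : Rule K) (n : ℕ) (η : WithTop ℝ) (i : Fin K) : ℝ :=
  match η with
  | ⊤ => if (G.ftlRun R n).L i = G.algBest R n then (G.ftlRun R n).mult i else 0
  | (η : ℝ) => (G.hcRun R η n).h i * (G.hcRun R η n).c i

/-- The probability that the algorithm with learning rate `η` gives to the expert `i` in round
`n + 1`. -/
def Game.algProb {K T : ℕ} (G : Game K T) (R : Rule K) (n : ℕ) (η : WithTop ℝ) (i : Fin K) : ℝ :=
  if i ∈ G.alive (n + 1) then
    G.algWeight R n η i / ∑ j ∈ G.alive (n + 1), G.algWeight R n η j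
  else 0

/-- The loss of the algorithm with learning rate `η` in round `n + 1`. -/
def Game.algLossAt {K T : ℕ} (G : Game K T) (R : Rule K) (n : ℕ) (η : WithTop ℝ) : ℝ :=
  ∑ i, G.algProb R n η i * G.loss (n + 1) i

/-- The mix loss of the algorithm with learning rate `η` in round `n + 1`. -/
def Game.algMixLoss {K T : ℕ} (G : Game K T) (R : Rule K) (n : ℕ) (η : WithTop ℝ) : ℝ :=
  match η with
  | ⊤ => G.algBestNext R n - G.algBest R n
  | (η : ℝ) =>
      -(1 / η) * Real.log (∑ i, G.algProb R n (η : WithTop ℝ) i *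
        Real.exp (-η * G.loss (n + 1) i))

/-- The bookkeeping of the extension of HPU / HPK to FlipFlop after `n` rounds. It uses only the
variables of the algorithm; the number of orderings is `∑ i, h_{i,1}`. -/
def Game.algState {K T : ℕ} (G : Game K T) (R : Rule K) (α φ : ℝ) : ℕ → FFState
  | 0 => FFState.start
  | n + 1 =>
      let s := G.algState R α φ n
      let η := s.rate (∑ i, R.init i)
      s.update α φ (G.algLossAt R n η - G.algMixLoss R n η)

/-- The learning rate of the extended algorithm in round `n + 1`. -/
def Game.algRate {K T : ℕ} (G : Game K T) (R : Rule K) (α φ : ℝ) (n : ℕ) : WithTop ℝ :=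
  (G.algState R α φ n).rate (∑ i, R.init i)

/-- The prediction of the extended algorithm in round `n + 1`. -/
def Game.algPlay {K T : ℕ} (G : Game K T) (R : Rule K) (α φ : ℝ) (n : ℕ) (i : Fin K) : ℝ :=
  G.algProb R n (G.algRate R α φ n) i

/-- The regret `R_A(1, n)` of the extended algorithm against the orderings in `A`. -/
def Game.algRegret {K T : ℕ} [NeZero K] (G : Game K T) (R : Rule K) (α φ : ℝ)
    (A : Finset (PermExpert K)) (n : ℕ) : ℝ :=
  ∑ k ∈ Finset.range n, ∑ i, G.algPlay R α φ k i * G.loss (k + 1) i - bestLoss A G.permLoss n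

/-- The extended algorithm simulates FlipFlop over the set `A` of orderings: in every round it has
the same bookkeeping, the same learning rate, the same weight and the same probability on every
(alive) expert as FlipFlop over `A` puts on the orderings that play this expert; and it knows
`L*_t`. -/
def Game.Simulates {K T : ℕ} [NeZero K] (G : Game K T) (R : Rule K) (α φ : ℝ)
    (A : Finset (PermExpert K)) : Prop :=
  (∀ n, n ≤ T → G.algState R α φ n = flipFlop α φ A G.permLoss n) ∧
  ∀ n, n < T →
    G.algRate R α φ n = flipFlopRate α φ A G.permLoss n ∧
    (∀ i ∈ G.alive (n + 1), G.algWeight R n (G.algRate R α φ n) i =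
      ∑ π ∈ A with G.sigma (n + 1) π = i,
        hedgeWeight A G.permLoss n (flipFlopRate α φ A G.permLoss n) π) ∧
    (∀ i, G.algPlay R α φ n i =
      ∑ π ∈ A with G.sigma (n + 1) π = i,
        hedgeProb A G.permLoss n (flipFlopRate α φ A G.permLoss n) π) ∧
    G.algBest R n = bestLoss A G.permLoss n ∧
    G.algBestNext R n = bestLoss A G.permLoss (n + 1)

/-- The regret bound
`min {C₀ R_A^ftl(1,n) + C₁, C₂ √(L*_n (n - L*_n) / n · ln |A|) + C₃ ln |A|}`. -/
def Game.bound {K T : ℕ} [NeZero K] (G : Game K T) (C₀ C₁ C₂ C₃ : ℝ)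
    (A : Finset (PermExpert K)) (n : ℕ) : ℝ :=
  min (C₀ * ftlRegret A G.permLoss n + C₁)
    (C₂ * Real.sqrt (bestLoss A G.permLoss n * ((n : ℝ) - bestLoss A G.permLoss n) / (n : ℝ)
        * Real.log (A.card : ℝ))
      + C₃ * Real.log (A.card : ℝ))

end

end DyingExperts

open DyingExperts

/-!
The extended algorithms run FlipFlop over a set `A` of orderings while keeping only one number (or
two) per expert. This works because the weight that Hedge or Follow the Leader gives to an ordering
is a function of its past, that is, of the experts it has played so far. When expert `j` dies, the
orderings that play `j` move on to the remaining experts, and the proportions in which they do so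
are the same for every past (`Splits`). So the total weight of the orderings that play `i`, and for
Follow the Leader the least loss among them with its multiplicity, can be updated from the
corresponding numbers of `i` and `j` alone (`HCState.Represents.die`, `FTLState.Represents.die`).

For the set of all orderings the proportions are equal (`splits_hpu`): an ordering that plays `j`
has never played another expert that is still alive, so exchanging two such experts in it does not
change its past. If the experts die in the order of their indices, the sets of alive experts are the
sets `tailSet K d`, and by downward induction on `d` every past that ends with playing `i` has
exactly `startCount K m i` continuations among the behaviors (`card_samePast`); hence effective
orderings move on in proportion to these numbers (`splits_hpk`).

The regret bounds then are those of FlipFlop over `A` (`exists_flipFlop_regret_lt`). Its loss is the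
sum of its mix loss, `Δ^flip` and `Δ^flop`. The mix loss of a round is the increment of the
`potential` of the current rate, and the potential decreases with the rate, so the total mix loss
exceeds `L*` by little more than the sum of the values of `Δ^flop` at the ends of the flop periods;
these grow geometrically (`flipFlopMix_le`). Since the switching rule keeps `Δ^flip` and `Δ^flop`
within constant factors of each other, the regret is of the order of either. On the one hand,
`Δ^flip` is at most the regret of Follow the Leader. On the other hand, the AdaHedge rate makes
`(Δ^flop) ^ 2` at most of the order of `ln |A|` times the sum of the variances of the losses
(`dFlop_sq_le`), which by Cauchy–Schwarz is at most `L* (n - L*) / n` plus the regret.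
-/

namespace DyingExperts

/-! ### Minima over finite sets and weighted averages -/

section Averages

variable {X : Type*} {s : Finset X} {f : X → ℝ}

lemma finMin_le {x : X} (hx : x ∈ s) : finMin s f ≤ f x := by
  rw [finMin, dif_pos ⟨x, hx⟩]
  exact Finset.inf'_le f hx

lemma exists_eq_finMin (hs : s.Nonempty) : ∃ x ∈ s, f x = finMin s f := by
  obtain ⟨x, hx, h⟩ := Finset.exists_mem_eq_inf' hs f
  exact ⟨x, hx, by rw [finMin, dif_pos hs, h]⟩

lemma le_finMin (hs : s.Nonempty) {c : ℝ} (h : ∀ x ∈ s, c ≤ f x) : c ≤ finMin s f := by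
  rw [finMin, dif_pos hs]
  exact Finset.le_inf' hs f h

variable {p : X → ℝ}

lemma sum_mul_mem_Icc (hp : ∀ x ∈ s, 0 ≤ p x) (h1 : ∑ x ∈ s, p x = 1)
    (hf : ∀ x ∈ s, f x ∈ Set.Icc (0 : ℝ) 1) : ∑ x ∈ s, p x * f x ∈ Set.Icc (0 : ℝ) 1 := by
  refine ⟨Finset.sum_nonneg fun x hx => mul_nonneg (hp x hx) (hf x hx).1, ?_⟩
  rw [← h1]
  exact Finset.sum_le_sum fun x hx => mul_le_of_le_one_right (hp x hx) (hf x hx).2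

lemma sum_mul_pos (hp : ∀ x ∈ s, 0 ≤ p x) (h1 : ∑ x ∈ s, p x = 1) (hf : ∀ x ∈ s, 0 < f x) :
    0 < ∑ x ∈ s, p x * f x := by
  obtain ⟨x, hx, h⟩ := Finset.exists_ne_zero_of_sum_ne_zero (h1.trans_ne one_ne_zero)
  exact Finset.sum_pos' (fun y hy => mul_nonneg (hp y hy) (hf y hy).le)
    ⟨x, hx, mul_pos (lt_of_le_of_ne (hp x hx) h.symm) (hf x hx)⟩

lemma exp_neg_mul_sum_le (hp : ∀ x ∈ s, 0 ≤ p x) (h1 : ∑ x ∈ s, p x = 1) (η : ℝ) :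
    Real.exp (-η * ∑ x ∈ s, p x * f x) ≤ ∑ x ∈ s, p x * Real.exp (-η * f x) := by
  have := convexOn_exp.map_sum_le (t := s) (w := p) (p := fun x => -η * f x) hp h1
    (fun _ _ => Set.mem_univ _)
  simp only [smul_eq_mul] at this
  refine le_trans (le_of_eq ?_) this
  rw [Finset.mul_sum]
  congr 1
  exact Finset.sum_congr rfl fun x _ => by ring

/-- Second-order upper bound on the moment generating function: the variance of a `[0, 1]`-valued
variable of mean `h` is at most `h (1 - h)`. -/
lemma sum_mul_exp_le (hp : ∀ x ∈ s, 0 ≤ p x) (h1 : ∑ x ∈ s, p x = 1)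
    (hf : ∀ x ∈ s, f x ∈ Set.Icc (0 : ℝ) 1) {η : ℝ} (hη : 0 ≤ η) (hη1 : η ≤ 1) {h : ℝ}
    (hh : h = ∑ x ∈ s, p x * f x) :
    ∑ x ∈ s, p x * Real.exp (-η * f x) ≤ Real.exp (-η * h + η ^ 2 * (h * (1 - h))) := by
  have hmem : h ∈ Set.Icc (0 : ℝ) 1 := hh ▸ sum_mul_mem_Icc hp h1 hf
  have key : ∀ x ∈ s, p x * Real.exp (-η * f x) ≤
      Real.exp (-η * h) * (p x * (1 + η * h + η ^ 2 * h ^ 2) - p x * f x * η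
        - 2 * η ^ 2 * h * (p x * f x) + η ^ 2 * (p x * f x)) := by
    intro x hx
    obtain ⟨h0, h1'⟩ := hf x hx
    have habs : |η * (h - f x)| ≤ 1 := by
      rw [abs_mul, abs_of_nonneg hη]
      exact mul_le_one₀ hη1 (abs_nonneg _)
        (abs_le.2 ⟨by linarith [hmem.1], by linarith [hmem.2]⟩)
    have hexp := (abs_le.1 (Real.abs_exp_sub_one_sub_id_le habs)).2
    have hsplit : Real.exp (-η * f x) = Real.exp (-η * h) * Real.exp (η * (h - f x)) := by
      rw [← Real.exp_add]; congr 1; ring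
    rw [hsplit, mul_left_comm]
    refine mul_le_mul_of_nonneg_left ?_ (Real.exp_pos _).le
    have hsq : f x ^ 2 ≤ f x := by nlinarith
    have : Real.exp (η * (h - f x)) ≤
        1 + η * h + η ^ 2 * h ^ 2 - f x * η - 2 * η ^ 2 * h * f x + η ^ 2 * f x := by
      nlinarith [mul_le_mul_of_nonneg_left hsq (sq_nonneg η)]
    calc p x * Real.exp (η * (h - f x)) ≤ p x * _ := mul_le_mul_of_nonneg_left this (hp x hx)
      _ = _ := by ring
  refine (Finset.sum_le_sum key).trans ?_
  rw [← Finset.mul_sum, Finset.sum_add_distrib, Finset.sum_sub_distrib, Finset.sum_sub_distrib,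
    ← Finset.sum_mul, ← Finset.sum_mul, ← Finset.mul_sum, ← Finset.mul_sum, h1, ← hh, Real.exp_add]
  refine mul_le_mul_of_nonneg_left ?_ (Real.exp_pos _).le
  refine le_trans (le_of_eq ?_) (Real.add_one_le_exp _)
  ring

end Averages

/-! ### Hedge and its mix loss -/

section Hedge

variable {X : Type*} {A : Finset X} {loss : ℕ → X → ℝ} {n : ℕ}

lemma cumLoss_zero (x : X) : cumLoss loss 0 x = 0 := by simp [cumLoss]

lemma cumLoss_succ (n : ℕ) (x : X) :
    cumLoss loss (n + 1) x = cumLoss loss n x + loss (n + 1) x := by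
  rw [cumLoss, Finset.sum_Icc_succ_top (by omega)]
  rfl

lemma bestLoss_zero (hA : A.Nonempty) : bestLoss A loss 0 = 0 := by
  obtain ⟨x, -, hx⟩ := exists_eq_finMin (f := cumLoss loss 0) hA
  rw [bestLoss, ← hx, cumLoss_zero]

lemma bestLoss_mono_succ (hA : A.Nonempty) (hl : ∀ x ∈ A, loss (n + 1) x ∈ Set.Icc (0 : ℝ) 1) :
    bestLoss A loss n ≤ bestLoss A loss (n + 1) := by
  refine le_finMin hA fun x hx => ?_
  rw [cumLoss_succ]
  exact (finMin_le hx).trans (le_add_of_nonneg_right (hl x hx).1)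

lemma bestLoss_mem_Icc (hA : A.Nonempty)
    (hl : ∀ t, 1 ≤ t → t ≤ n → ∀ x ∈ A, loss t x ∈ Set.Icc (0 : ℝ) 1) :
    bestLoss A loss n ∈ Set.Icc (0 : ℝ) n := by
  obtain ⟨x, hx, hb⟩ := exists_eq_finMin (f := cumLoss loss n) hA
  rw [bestLoss, ← hb, cumLoss]
  refine ⟨Finset.sum_nonneg fun t ht => ?_, ?_⟩
  · rw [Finset.mem_Icc] at ht
    exact (hl t ht.1 ht.2 x hx).1
  · refine (Finset.sum_le_card_nsmul _ _ 1 fun t ht => ?_).trans (by simp)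
    rw [Finset.mem_Icc] at ht
    exact (hl t ht.1 ht.2 x hx).2

lemma hedgeWeight_nonneg (η : WithTop ℝ) (x : X) : 0 ≤ hedgeWeight A loss n η x := by
  induction η using WithTop.recTopCoe with
  | top => simp only [hedgeWeight]; split_ifs <;> norm_num
  | coe η => exact (Real.exp_pos _).le

lemma sum_hedgeWeight_pos (hA : A.Nonempty) (η : WithTop ℝ) :
    0 < ∑ x ∈ A, hedgeWeight A loss n η x := by
  induction η using WithTop.recTopCoe with
  | top =>
    obtain ⟨x, hx, hb⟩ := exists_eq_finMin (f := cumLoss loss n) hA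
    refine Finset.sum_pos' (fun y _ => hedgeWeight_nonneg _ y) ⟨x, hx, ?_⟩
    have hb' : cumLoss loss n x = bestLoss A loss n := hb
    simp only [hedgeWeight]
    rw [if_pos hb']
    exact one_pos
  | coe η => exact Finset.sum_pos (fun x _ => Real.exp_pos _) hA

lemma hedgeProb_nonneg (η : WithTop ℝ) (x : X) : 0 ≤ hedgeProb A loss n η x :=
  div_nonneg (hedgeWeight_nonneg η x) (Finset.sum_nonneg fun y _ => hedgeWeight_nonneg η y)

lemma sum_hedgeProb (hA : A.Nonempty) (η : WithTop ℝ) : ∑ x ∈ A, hedgeProb A loss n η x = 1 := by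
  simp only [hedgeProb]
  rw [← Finset.sum_div, div_self (sum_hedgeWeight_pos hA η).ne']

lemma hedgeLoss_mem_Icc (hA : A.Nonempty) (hl : ∀ x ∈ A, loss (n + 1) x ∈ Set.Icc (0 : ℝ) 1)
    (η : WithTop ℝ) : hedgeLoss A loss n η ∈ Set.Icc (0 : ℝ) 1 :=
  sum_mul_mem_Icc (fun x _ => hedgeProb_nonneg η x) (sum_hedgeProb hA η) hl

/-- The mixability gap of Hedge with rate `η` in round `n + 1`. -/
noncomputable def mixGap (A : Finset X) (loss : ℕ → X → ℝ) (n : ℕ) (η : WithTop ℝ) : ℝ :=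
  hedgeLoss A loss n η - hedgeMixLoss A loss n η

lemma hedgeMixLoss_nonneg (hA : A.Nonempty) (hl : ∀ x ∈ A, loss (n + 1) x ∈ Set.Icc (0 : ℝ) 1)
    {η : WithTop ℝ} (hη : 0 < η) : 0 ≤ hedgeMixLoss A loss n η := by
  induction η using WithTop.recTopCoe with
  | top => exact sub_nonneg.2 (bestLoss_mono_succ hA hl)
  | coe η =>
    have hη' : 0 < η := by exact_mod_cast hη
    simp only [hedgeMixLoss]
    rw [neg_mul, neg_nonneg]
    refine mul_nonpos_of_nonneg_of_nonpos (by positivity) (Real.log_nonpos ?_ ?_)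
    · exact Finset.sum_nonneg fun x _ => mul_nonneg (hedgeProb_nonneg _ x) (Real.exp_pos _).le
    · rw [← sum_hedgeProb (loss := loss) (n := n) hA (η : WithTop ℝ)]
      refine Finset.sum_le_sum fun x hx => mul_le_of_le_one_right (hedgeProb_nonneg _ x) ?_
      rw [Real.exp_le_one_iff]
      nlinarith [(hl x hx).1]

lemma mixGap_nonneg (hA : A.Nonempty) {η : WithTop ℝ} (hη : 0 < η) : 0 ≤ mixGap A loss n η := by
  rw [mixGap, sub_nonneg]
  induction η using WithTop.recTopCoe with
  | top =>
    simp only [hedgeMixLoss, hedgeLoss]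
    have h1 := sum_hedgeProb (loss := loss) (n := n) hA ⊤
    rw [← mul_one (bestLoss A loss (n + 1) - bestLoss A loss n), ← h1, Finset.mul_sum]
    refine Finset.sum_le_sum fun x hx => ?_
    by_cases hx' : cumLoss loss n x = bestLoss A loss n
    · rw [mul_comm]
      refine mul_le_mul_of_nonneg_left ?_ (hedgeProb_nonneg _ x)
      have : bestLoss A loss (n + 1) ≤ cumLoss loss (n + 1) x := finMin_le hx
      rw [cumLoss_succ] at this
      linarith
    · simp [hedgeProb, hedgeWeight, hx']
  | coe η =>
    have hη' : 0 < η := by exact_mod_cast hη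
    simp only [hedgeMixLoss]
    have h := Real.log_le_log (Real.exp_pos _) (exp_neg_mul_sum_le (f := loss (n + 1))
      (fun x _ => hedgeProb_nonneg (A := A) (loss := loss) (n := n) η x) (sum_hedgeProb hA _) η)
    rw [Real.log_exp] at h
    change _ ≤ ∑ x ∈ A, hedgeProb A loss n η x * loss (n + 1) x
    rw [neg_mul, neg_le, one_div, ← div_eq_inv_mul, le_div_iff₀ hη']
    linarith

lemma mixGap_le_one (hA : A.Nonempty) (hl : ∀ x ∈ A, loss (n + 1) x ∈ Set.Icc (0 : ℝ) 1)
    {η : WithTop ℝ} (hη : 0 < η) : mixGap A loss n η ≤ 1 := by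
  have h1 := (hedgeLoss_mem_Icc hA hl η).2
  have h2 := hedgeMixLoss_nonneg hA hl hη
  rw [mixGap]
  linarith

/-- If `η ≤ 1`, then the mixability gap is at most `η` times the bound `h (1 - h)` on the variance
of the losses, `h` being the loss of Hedge; if `η ≥ 1`, it trivially is at most `η` times itself. -/
lemma mixGap_le (hA : A.Nonempty) (hl : ∀ x ∈ A, loss (n + 1) x ∈ Set.Icc (0 : ℝ) 1)
    {η : ℝ} (hη : 0 < η) :
    mixGap A loss n η ≤
      η * (hedgeLoss A loss n η * (1 - hedgeLoss A loss n η) + mixGap A loss n η) := by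
  have hη' : (0 : WithTop ℝ) < η := by exact_mod_cast hη
  have h0 := mixGap_nonneg (loss := loss) (n := n) hA hη'
  have hh := hedgeLoss_mem_Icc hA hl (η : WithTop ℝ)
  have hv : 0 ≤ hedgeLoss A loss n η * (1 - hedgeLoss A loss n η) :=
    mul_nonneg hh.1 (sub_nonneg.2 hh.2)
  rcases le_total 1 η with h1 | h1
  · nlinarith
  · have hp : ∀ x ∈ A, 0 ≤ hedgeProb A loss n η x := fun x _ => hedgeProb_nonneg _ x
    have h := Real.log_le_log (sum_mul_pos hp (sum_hedgeProb hA _) fun x _ => Real.exp_pos _)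
      (sum_mul_exp_le hp (sum_hedgeProb hA _) hl hη.le h1 rfl)
    rw [Real.log_exp] at h
    change _ ≤ -η * hedgeLoss A loss n η +
      η ^ 2 * (hedgeLoss A loss n η * (1 - hedgeLoss A loss n η)) at h
    have h2 : mixGap A loss n η ≤ η * (hedgeLoss A loss n η * (1 - hedgeLoss A loss n η)) := by
      rw [mixGap]
      simp only [hedgeMixLoss]
      rw [neg_mul, sub_neg_eq_add, one_div, ← div_eq_inv_mul, ← le_sub_iff_add_le', div_le_iff₀ hη]
      nlinarith
    nlinarith

/-- The total mix loss after `n` rounds of Hedge when it uses the same rate `η` in all of them,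
written in closed form: `-(1/η)` times the logarithm of the mean of the final weights, and `L*_n`
for the rate `⊤`. -/
noncomputable def potential (A : Finset X) (loss : ℕ → X → ℝ) (n : ℕ) (η : WithTop ℝ) : ℝ :=
  match η with
  | ⊤ => bestLoss A loss n
  | (η : ℝ) => -(1 / η) * Real.log (∑ x ∈ A, 1 / (A.card : ℝ) * Real.exp (-η * cumLoss loss n x))

lemma sum_inv_card (hA : A.Nonempty) : ∑ _x ∈ A, 1 / (A.card : ℝ) = 1 := by
  have : (A.card : ℝ) ≠ 0 := by exact_mod_cast hA.card_pos.ne'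
  simp [this]

lemma hedgeMixLoss_eq (hA : A.Nonempty) (η : WithTop ℝ) :
    hedgeMixLoss A loss n η = potential A loss (n + 1) η - potential A loss n η := by
  induction η using WithTop.recTopCoe with
  | top => rfl
  | coe η =>
    simp only [hedgeMixLoss, potential, hedgeProb, hedgeWeight]
    have hpos : ∀ k, 0 < ∑ x ∈ A, Real.exp (-η * cumLoss loss k x) := fun k =>
      Finset.sum_pos (fun x _ => Real.exp_pos _) hA
    have hc : (1 / (A.card : ℝ)) ≠ 0 := by
      have : (A.card : ℝ) ≠ 0 := by exact_mod_cast hA.card_pos.ne'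
      positivity
    have hsum : ∑ x ∈ A, Real.exp (-η * cumLoss loss n x) /
        (∑ y ∈ A, Real.exp (-η * cumLoss loss n y)) * Real.exp (-η * loss (n + 1) x) =
        (∑ x ∈ A, Real.exp (-η * cumLoss loss (n + 1) x)) /
          ∑ y ∈ A, Real.exp (-η * cumLoss loss n y) := by
      rw [Finset.sum_div]
      refine Finset.sum_congr rfl fun x _ => ?_
      rw [cumLoss_succ, mul_add, Real.exp_add, div_mul_eq_mul_div]
    rw [hsum, ← Finset.mul_sum, ← Finset.mul_sum, Real.log_div (hpos _).ne' (hpos _).ne',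
      Real.log_mul hc (hpos _).ne', Real.log_mul hc (hpos _).ne']
    ring

lemma potential_le (hA : A.Nonempty) {η : ℝ} (hη : 0 < η) :
    potential A loss n η ≤ bestLoss A loss n + Real.log A.card / η := by
  obtain ⟨x, hx, hb⟩ := exists_eq_finMin (f := cumLoss loss n) hA
  have hc : (0 : ℝ) < A.card := by exact_mod_cast hA.card_pos
  have h : 1 / (A.card : ℝ) * Real.exp (-η * bestLoss A loss n) ≤
      ∑ x ∈ A, 1 / (A.card : ℝ) * Real.exp (-η * cumLoss loss n x) := by
    rw [bestLoss, ← hb]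
    exact Finset.single_le_sum (f := fun x => 1 / (A.card : ℝ) * Real.exp (-η * cumLoss loss n x))
      (fun y _ => by positivity) hx
  have h2 := Real.log_le_log (by positivity) h
  rw [Real.log_mul (by positivity) (Real.exp_pos _).ne', Real.log_exp, one_div, Real.log_inv] at h2
  simp only [potential]
  rw [neg_mul, one_div, ← div_eq_inv_mul, ← neg_div, div_le_iff₀ hη, add_mul,
    div_mul_cancel₀ _ hη.ne', one_div]
  linarith

/-- Larger rates have smaller potentials, by the inequality between power means. -/
lemma potential_anti (hA : A.Nonempty) {η η' : WithTop ℝ} (hη' : 0 < η') (h : η' ≤ η) :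
    potential A loss n η ≤ potential A loss n η' := by
  have hc : (0 : ℝ) < A.card := by exact_mod_cast hA.card_pos
  induction η' using WithTop.recTopCoe with
  | top => rw [top_le_iff.1 h]
  | coe b =>
    have hb : 0 < b := by exact_mod_cast hη'
    have hpos : ∀ c : ℝ, 0 < ∑ x ∈ A, 1 / (A.card : ℝ) * Real.exp (-c * cumLoss loss n x) :=
      fun c => Finset.sum_pos (fun x _ => by positivity) hA
    induction η using WithTop.recTopCoe with
    | top =>
      simp only [potential]
      rw [neg_mul, one_div, ← div_eq_inv_mul, ← neg_div, le_div_iff₀ hb]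
      have h1 : ∑ x ∈ A, 1 / (A.card : ℝ) * Real.exp (-b * cumLoss loss n x) ≤
          Real.exp (-b * bestLoss A loss n) := by
        refine le_of_le_of_eq (b := ∑ _x ∈ A, 1 / (A.card : ℝ) * Real.exp (-b * bestLoss A loss n))
          ?_ (by rw [← Finset.sum_mul, sum_inv_card hA, one_mul])
        refine Finset.sum_le_sum fun x hx => mul_le_mul_of_nonneg_left
          (Real.exp_le_exp.2 ?_) (by positivity)
        have : bestLoss A loss n ≤ cumLoss loss n x := finMin_le hx
        nlinarith
      have h2 := Real.log_le_log (hpos b) h1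
      rw [Real.log_exp] at h2
      linarith
    | coe a =>
      have hab : b ≤ a := by exact_mod_cast h
      have ha : 0 < a := hb.trans_le hab
      have h1 := Real.rpow_arith_mean_le_arith_mean_rpow A (fun _ => 1 / (A.card : ℝ))
        (fun x => Real.exp (-b * cumLoss loss n x)) (fun _ _ => by positivity) (sum_inv_card hA)
        (fun _ _ => (Real.exp_pos _).le) (p := a / b) ((one_le_div hb).2 hab)
      have h2 : ∀ x, Real.exp (-b * cumLoss loss n x) ^ (a / b) =
          Real.exp (-a * cumLoss loss n x) := fun x => by
        rw [← Real.exp_mul]; congr 1; field_simp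
      simp only [h2] at h1
      have h3 := Real.log_le_log (Real.rpow_pos_of_pos (hpos b) _) h1
      rw [Real.log_rpow (hpos b)] at h3
      simp only [potential]
      rw [neg_mul, neg_mul, neg_le_neg_iff]
      calc 1 / b * Real.log (∑ x ∈ A, 1 / (A.card : ℝ) * Real.exp (-b * cumLoss loss n x))
          = 1 / a * (a / b *
            Real.log (∑ x ∈ A, 1 / (A.card : ℝ) * Real.exp (-b * cumLoss loss n x))) := by
            field_simp
        _ ≤ _ := mul_le_mul_of_nonneg_left h3 (by positivity)

lemma ftlRegret_eq_sum_mixGap (hA : A.Nonempty) :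
    ftlRegret A loss n = ∑ k ∈ Finset.range n, mixGap A loss k ⊤ := by
  simp only [mixGap]
  rw [ftlRegret, Finset.sum_sub_distrib]
  have : ∀ k, hedgeMixLoss A loss k ⊤ = bestLoss A loss (k + 1) - bestLoss A loss k := fun _ => rfl
  simp only [this]
  rw [Finset.sum_range_sub, bestLoss_zero hA, sub_zero]

end Hedge

/-! ### The regret of FlipFlop -/

section FlipFlop

variable {X : Type*} {α φ : ℝ} {A : Finset X} {loss : ℕ → X → ℝ}

lemma flipFlop_succ (n : ℕ) : flipFlop α φ A loss (n + 1) =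
    (flipFlop α φ A loss n).update α φ (mixGap A loss n (flipFlopRate α φ A loss n)) := rfl

namespace FFState

lemma rate_of_flip {N : ℝ} {s : FFState} (h : s.inFlop = false) : s.rate N = ⊤ := by
  simp [rate, h]

lemma rate_of_zero {N : ℝ} {s : FFState} (h : s.dFlop = 0) : s.rate N = ⊤ := by
  simp [rate, h]

lemma rate_of_flop {N : ℝ} {s : FFState} (h : s.inFlop = true) (h0 : s.dFlop ≠ 0) :
    s.rate N = ((Real.log N / s.dFlop : ℝ) : WithTop ℝ) := by
  simp [rate, h, h0]

lemma rate_pos {N : ℝ} (hN : 1 < N) {s : FFState} (h0 : 0 ≤ s.dFlop) : 0 < s.rate N := by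
  unfold rate
  split_ifs with h
  · have : 0 < Real.log N / s.dFlop := div_pos (Real.log_pos hN) (lt_of_le_of_ne h0 (Ne.symm h.2))
    exact_mod_cast this
  · exact WithTop.coe_lt_top 0

section Update

variable {α φ δ : ℝ} {s : FFState}

lemma update_dFlip_of_flip (h : s.inFlop = false) :
    (s.update α φ δ).dFlip = s.dFlip + δ := by simp [update, h]

lemma update_dFlop_of_flip (h : s.inFlop = false) :
    (s.update α φ δ).dFlop = s.dFlop := by simp [update, h]

lemma update_inFlop_of_flip (h : s.inFlop = false) :
    (s.update α φ δ).inFlop = true ↔ φ / α * s.dFlop < s.dFlip + δ := by simp [update, h]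

lemma update_dFlip_of_flop (h : s.inFlop = true) :
    (s.update α φ δ).dFlip = s.dFlip := by simp [update, h]

lemma update_dFlop_of_flop (h : s.inFlop = true) :
    (s.update α φ δ).dFlop = s.dFlop + δ := by simp [update, h]

lemma update_inFlop_of_flop (h : s.inFlop = true) :
    (s.update α φ δ).inFlop = false ↔ α * s.dFlip < s.dFlop + δ := by simp [update, h]

end Update

/-- The relations between the two accumulated gaps that the switching rule of FlipFlop maintains:
each is bounded by a multiple of the other, up to the gap of one round. -/
structure Balanced (α φ : ℝ) (s : FFState) : Prop where
  dFlip_nonneg : 0 ≤ s.dFlip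
  dFlop_nonneg : 0 ≤ s.dFlop
  dFlip_le : s.dFlip ≤ φ / α * s.dFlop + 1
  dFlop_le : s.dFlop ≤ α * s.dFlip + 1
  of_flip : s.inFlop = false → s.dFlip ≤ φ / α * s.dFlop
  of_flop : s.inFlop = true → s.dFlop ≤ α * s.dFlip

lemma balanced_start : Balanced α φ start := by
  constructor <;> simp [start]

lemma Balanced.update (hα : 0 < α) (hφ : 1 < φ) {s : FFState} (hs : s.Balanced α φ) {δ : ℝ}
    (h0 : 0 ≤ δ) (h1 : δ ≤ 1) : (s.update α φ δ).Balanced α φ := by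
  obtain ⟨ha, hb, hab, hba, hi, ho⟩ := hs
  have hφα : 0 < φ / α := by positivity
  rcases Bool.eq_false_or_eq_true s.inFlop with hf | hf
  · have ho := ho hf
    have h3 : 0 ≤ φ / α * δ := by positivity
    have hsw := update_inFlop_of_flop (α := α) (φ := φ) (δ := δ) hf
    rw [← Bool.not_eq_true] at hsw
    constructor <;> simp only [update_dFlip_of_flop hf, update_dFlop_of_flop hf] <;>
      try linarith
    · intro h
      rw [← Bool.not_eq_true, hsw] at h
      rw [div_mul_eq_mul_div, le_div_iff₀ hα]
      nlinarith
    · exact fun h => not_lt.1 fun h' => hsw.2 h' h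
  · have hi := hi hf
    have hsw := update_inFlop_of_flip (α := α) (φ := φ) (δ := δ) hf
    constructor <;> simp only [update_dFlip_of_flip hf, update_dFlop_of_flip hf] <;>
      try linarith
    · nlinarith
    · intro h
      rw [← Bool.not_eq_true, hsw] at h
      exact not_lt.1 h
    · intro h
      have h2 : α * (φ / α * s.dFlop) ≤ α * (s.dFlip + δ) :=
        mul_le_mul_of_nonneg_left (hsw.1 h).le hα.le
      have h3 : α * (φ / α * s.dFlop) = φ * s.dFlop := by field_simp
      nlinarith

end FFState

variable (α φ A loss) in
/-- The loss of FlipFlop in round `n + 1`. -/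
noncomputable def flipFlopLoss (n : ℕ) : ℝ := hedgeLoss A loss n (flipFlopRate α φ A loss n)

variable (α φ A loss) in
/-- The mix loss of FlipFlop in round `n + 1`. -/
noncomputable def flipFlopMixLoss (n : ℕ) : ℝ := hedgeMixLoss A loss n (flipFlopRate α φ A loss n)

variable (α φ A loss) in
/-- The total mix loss of FlipFlop over the first `n` rounds. -/
noncomputable def flipFlopMix (n : ℕ) : ℝ := ∑ k ∈ Finset.range n, flipFlopMixLoss α φ A loss k

lemma sum_flipFlopLoss_eq (n : ℕ) : ∑ k ∈ Finset.range n, flipFlopLoss α φ A loss k =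
    flipFlopMix α φ A loss n + (flipFlop α φ A loss n).dFlip + (flipFlop α φ A loss n).dFlop := by
  induction n with
  | zero => simp [flipFlop, FFState.start, flipFlopMix]
  | succ n ih =>
    rw [Finset.sum_range_succ, ih, flipFlop_succ, flipFlopMix, flipFlopMix, Finset.sum_range_succ,
      flipFlopLoss, flipFlopMixLoss, mixGap]
    rcases Bool.eq_false_or_eq_true (flipFlop α φ A loss n).inFlop with h | h
    · rw [FFState.update_dFlip_of_flop h, FFState.update_dFlop_of_flop h]; ring
    · rw [FFState.update_dFlip_of_flip h, FFState.update_dFlop_of_flip h]; ring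

/-- The flip rounds are rounds of Follow the Leader, so their gaps are among those of Follow the
Leader. -/
lemma dFlip_le_ftlRegret (hne : A.Nonempty) (n : ℕ) :
    (flipFlop α φ A loss n).dFlip ≤ ftlRegret A loss n := by
  rw [ftlRegret_eq_sum_mixGap hne]
  induction n with
  | zero => simp [flipFlop, FFState.start]
  | succ n ih =>
    have h0 : 0 ≤ mixGap A loss n ⊤ := mixGap_nonneg hne (WithTop.coe_lt_top 0)
    rw [Finset.sum_range_succ, flipFlop_succ]
    rcases Bool.eq_false_or_eq_true (flipFlop α φ A loss n).inFlop with h | h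
    · rw [FFState.update_dFlip_of_flop h]
      linarith
    · have htop : flipFlopRate α φ A loss n = ⊤ := FFState.rate_of_flip h
      rw [FFState.update_dFlip_of_flip h, htop]
      linarith

variable {T : ℕ} (hα : 0 < α) (hφ : 1 < φ) (hA : 2 ≤ A.card)
  (hl : ∀ t, 1 ≤ t → t ≤ T → ∀ x ∈ A, loss t x ∈ Set.Icc (0 : ℝ) 1)

include hα hφ hA hl

lemma balanced_flipFlop {n : ℕ} (hn : n ≤ T) : (flipFlop α φ A loss n).Balanced α φ := by
  have hne : A.Nonempty := Finset.card_pos.1 (by omega)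
  have hN : (1 : ℝ) < A.card := by exact_mod_cast hA
  induction n with
  | zero => exact FFState.balanced_start
  | succ n ih =>
    have ih := ih (by omega)
    have hη : 0 < flipFlopRate α φ A loss n := FFState.rate_pos hN ih.dFlop_nonneg
    rw [flipFlop_succ]
    exact ih.update hα hφ (mixGap_nonneg hne hη) (mixGap_le_one hne (hl _ (by omega) hn) hη)

lemma flipFlopRate_pos {n : ℕ} (hn : n ≤ T) : 0 < flipFlopRate α φ A loss n :=
  FFState.rate_pos (by exact_mod_cast hA) (balanced_flipFlop hα hφ hA hl hn).dFlop_nonneg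

/-- With the AdaHedge rate `ln |A| / Δ`, the increment `2 Δ δ + δ ^ 2` of `Δ ^ 2` is bounded
by the variance of the losses, up to a multiple of the increment `δ` of `Δ`. -/
lemma dFlop_sq_le {n : ℕ} (hn : n ≤ T) :
    (flipFlop α φ A loss n).dFlop ^ 2 ≤
      (1 + 2 * Real.log A.card) * (flipFlop α φ A loss n).dFlop + 2 * Real.log A.card *
        ∑ k ∈ Finset.range n, flipFlopLoss α φ A loss k * (1 - flipFlopLoss α φ A loss k) := by
  have hne : A.Nonempty := Finset.card_pos.1 (by omega)
  have hN : (1 : ℝ) < A.card := by exact_mod_cast hA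
  have hlog := Real.log_pos hN
  induction n with
  | zero => simp [flipFlop, FFState.start]
  | succ n ih =>
    have ih := ih (by omega)
    have hl' := hl (n + 1) (by omega) hn
    have hη := flipFlopRate_pos hα hφ hA hl (n := n) (by omega)
    have hb := (balanced_flipFlop hα hφ hA hl (n := n) (by omega)).dFlop_nonneg
    have hd0 := mixGap_nonneg (loss := loss) (n := n) hne hη
    have hd1 := mixGap_le_one hne hl' hη
    have hL := hedgeLoss_mem_Icc hne hl' (flipFlopRate α φ A loss n)
    have hv : 0 ≤ flipFlopLoss α φ A loss n * (1 - flipFlopLoss α φ A loss n) :=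
      mul_nonneg hL.1 (sub_nonneg.2 hL.2)
    have hlv := mul_nonneg (mul_nonneg zero_le_two hlog.le) hv
    have hdd : mixGap A loss n (flipFlopRate α φ A loss n) ^ 2 ≤
        mixGap A loss n (flipFlopRate α φ A loss n) := by nlinarith
    rw [Finset.sum_range_succ, flipFlop_succ, mul_add]
    rcases Bool.eq_false_or_eq_true (flipFlop α φ A loss n).inFlop with h | h
    · rw [FFState.update_dFlop_of_flop h]
      have key : mixGap A loss n (flipFlopRate α φ A loss n) * (flipFlop α φ A loss n).dFlop ≤
          Real.log A.card * (flipFlopLoss α φ A loss n * (1 - flipFlopLoss α φ A loss n) +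
            mixGap A loss n (flipFlopRate α φ A loss n)) := by
        rcases hb.eq_or_lt' with h0 | h0
        · rw [h0, mul_zero]
          exact mul_nonneg hlog.le (add_nonneg hv hd0)
        · have hr : flipFlopRate α φ A loss n = _ := FFState.rate_of_flop h h0.ne'
          have key := mixGap_le hne hl' (div_pos hlog h0)
          rwa [← hr, div_mul_eq_mul_div, le_div_iff₀ h0] at key
      linarith
    · rw [FFState.update_dFlop_of_flip h]
      linarith

/-- In the flop regime the comparator is the potential of the current rate, which only grows as the
rate decreases. Each switch back to flip costs the current `Δ^flop`; these costs grow
geometrically with ratio `φ`, so that `φ / (φ - 1)` times the last one bounds their sum. -/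
lemma flipFlopMix_le {n : ℕ} (hn : n ≤ T) :
    ((flipFlop α φ A loss n).inFlop = false →
      flipFlopMix α φ A loss n ≤
        bestLoss A loss n + φ / (φ - 1) * (flipFlop α φ A loss n).dFlop) ∧
    ((flipFlop α φ A loss n).inFlop = true →
      flipFlopMix α φ A loss n ≤ potential A loss n (flipFlopRate α φ A loss n) +
        α / (φ - 1) * (flipFlop α φ A loss n).dFlip) := by
  have hne : A.Nonempty := Finset.card_pos.1 (by omega)
  have hN : (1 : ℝ) < A.card := by exact_mod_cast hA
  have hlog := Real.log_pos hN
  have hφ' : 0 < φ - 1 := by linarith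
  induction n with
  | zero => simp [flipFlop, FFState.start, flipFlopMix, bestLoss_zero hne]
  | succ n ih =>
    obtain ⟨ihi, iho⟩ := ih (by omega)
    have hη := flipFlopRate_pos hα hφ hA hl (n := n) (by omega)
    have hη' := flipFlopRate_pos hα hφ hA hl hn
    have hbal := balanced_flipFlop hα hφ hA hl (n := n) (by omega)
    have hd0 := mixGap_nonneg (loss := loss) (n := n) hne hη
    have hM : flipFlopMix α φ A loss (n + 1) = flipFlopMix α φ A loss n +
        (potential A loss (n + 1) (flipFlopRate α φ A loss n) -
          potential A loss n (flipFlopRate α φ A loss n)) := by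
      rw [flipFlopMix, Finset.sum_range_succ, flipFlopMixLoss, hedgeMixLoss_eq hne]; rfl
    have hs := flipFlop_succ (α := α) (φ := φ) (A := A) (loss := loss) n
    set s := flipFlop α φ A loss n with hs_def
    set s' := flipFlop α φ A loss (n + 1) with hs'_def
    set δ := mixGap A loss n (flipFlopRate α φ A loss n)
    rcases Bool.eq_false_or_eq_true s.inFlop with hf | hf
    · have iho := iho hf
      have hflip : s'.dFlip = s.dFlip := hs ▸ FFState.update_dFlip_of_flop hf
      have hflop : s'.dFlop = s.dFlop + δ := hs ▸ FFState.update_dFlop_of_flop hf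
      refine ⟨fun hf' => ?_, fun hf' => ?_⟩
      · have hsw : α * s.dFlip < s.dFlop + δ := by
          rwa [hs, FFState.update_inFlop_of_flop hf] at hf'
        have hpot : potential A loss (n + 1) (flipFlopRate α φ A loss n) ≤
            bestLoss A loss (n + 1) + s.dFlop := by
          rcases hbal.dFlop_nonneg.eq_or_lt' with h0 | h0
          · have : flipFlopRate α φ A loss n = ⊤ := FFState.rate_of_zero h0
            rw [this, h0, add_zero]
            exact le_rfl
          · have hr : flipFlopRate α φ A loss n = _ := FFState.rate_of_flop hf h0.ne'
            rw [hr]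
            refine (potential_le hne (div_pos hlog h0)).trans (le_of_eq ?_)
            field_simp
        have h1 : α / (φ - 1) * s.dFlip ≤ 1 / (φ - 1) * (s.dFlop + δ) := by
          rw [div_mul_eq_mul_div, div_mul_eq_mul_div, one_mul]
          exact div_le_div_of_nonneg_right hsw.le hφ'.le
        have h2 : φ / (φ - 1) * (s.dFlop + δ) =
            (s.dFlop + δ) + 1 / (φ - 1) * (s.dFlop + δ) := by
          field_simp; ring
        rw [hflop, h2]
        linarith
      · have hrate : flipFlopRate α φ A loss (n + 1) ≤ flipFlopRate α φ A loss n := by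
          rcases hbal.dFlop_nonneg.eq_or_lt' with h0 | h0
          · have : flipFlopRate α φ A loss n = ⊤ := FFState.rate_of_zero h0
            rw [this]
            exact le_top
          · have hr : flipFlopRate α φ A loss n = _ := FFState.rate_of_flop hf h0.ne'
            have h0' : 0 < s'.dFlop := by linarith
            have hr' : flipFlopRate α φ A loss (n + 1) = _ := FFState.rate_of_flop hf' h0'.ne'
            rw [hr, hr']
            have : Real.log A.card / s'.dFlop ≤ Real.log A.card / s.dFlop :=
              div_le_div_of_nonneg_left hlog.le h0 (by linarith)
            exact_mod_cast this
        have := potential_anti (loss := loss) (n := n + 1) hne hη' hrate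
        rw [hflip]
        linarith
    · have ihi := ihi hf
      have htop : flipFlopRate α φ A loss n = ⊤ := FFState.rate_of_flip hf
      have hflip : s'.dFlip = s.dFlip + δ := hs ▸ FFState.update_dFlip_of_flip hf
      have hflop : s'.dFlop = s.dFlop := hs ▸ FFState.update_dFlop_of_flip hf
      have hM' : flipFlopMix α φ A loss (n + 1) ≤
          bestLoss A loss (n + 1) + φ / (φ - 1) * s.dFlop := by
        rw [hM, htop]
        change _ + (bestLoss A loss (n + 1) - bestLoss A loss n) ≤ _
        linarith
      refine ⟨fun _ => by rwa [hflop], fun hf' => ?_⟩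
      have hsw : φ / α * s.dFlop < s.dFlip + δ := by
        rwa [hs, FFState.update_inFlop_of_flip hf] at hf'
      have h1 : φ / (φ - 1) * s.dFlop ≤ α / (φ - 1) * (s.dFlip + δ) := by
        calc φ / (φ - 1) * s.dFlop = α / (φ - 1) * (φ / α * s.dFlop) := by field_simp
          _ ≤ _ := mul_le_mul_of_nonneg_left hsw.le (by positivity)
      have h2 := potential_anti (loss := loss) (n := n + 1) hne hη' le_top
      change bestLoss A loss (n + 1) ≤ _ at h2
      rw [hflip]
      linarith

lemma sum_flipFlopLoss_le {n : ℕ} (hn : n ≤ T) :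
    ∑ k ∈ Finset.range n, flipFlopLoss α φ A loss k ≤ bestLoss A loss n +
      (1 + α / (φ - 1)) * (flipFlop α φ A loss n).dFlip +
      (2 + φ / (φ - 1)) * (flipFlop α φ A loss n).dFlop := by
  have hne : A.Nonempty := Finset.card_pos.1 (by omega)
  have hN : (1 : ℝ) < A.card := by exact_mod_cast hA
  have hφ' : 0 < φ - 1 := by linarith
  have hbal := balanced_flipFlop hα hφ hA hl hn
  obtain ⟨hi, ho⟩ := flipFlopMix_le hα hφ hA hl hn
  rw [sum_flipFlopLoss_eq]
  have h1 : 0 ≤ α / (φ - 1) * (flipFlop α φ A loss n).dFlip :=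
    mul_nonneg (by positivity) hbal.dFlip_nonneg
  have h2 : 0 ≤ φ / (φ - 1) * (flipFlop α φ A loss n).dFlop :=
    mul_nonneg (by positivity) hbal.dFlop_nonneg
  rcases Bool.eq_false_or_eq_true (flipFlop α φ A loss n).inFlop with hf | hf
  · have ho := ho hf
    have hpot : potential A loss n (flipFlopRate α φ A loss n) ≤
        bestLoss A loss n + (flipFlop α φ A loss n).dFlop := by
      rcases hbal.dFlop_nonneg.eq_or_lt' with h0 | h0
      · have : flipFlopRate α φ A loss n = ⊤ := FFState.rate_of_zero h0
        rw [this, h0, add_zero]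
        exact le_rfl
      · have hr : flipFlopRate α φ A loss n = _ := FFState.rate_of_flop hf h0.ne'
        rw [hr]
        refine (potential_le hne (div_pos (Real.log_pos hN) h0)).trans (le_of_eq ?_)
        have := (Real.log_pos hN).ne'
        field_simp
    linarith
  · have hi := hi hf
    linarith [hbal.dFlop_nonneg]

end FlipFlop

lemma le_sqrt_of_sq_le {D g l d e : ℝ} (hg : 0 ≤ g) (hl : 1 / 2 < l) (hd : 4 ≤ d) (he : e ≤ d)
    (h : D ^ 2 ≤ 2 * g + d * l * D + e * l) : D ≤ 2 * √g + 2 * d * l := by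
  have hs := Real.sq_sqrt hg
  have hs0 := Real.sqrt_nonneg g
  have hdl : 1 ≤ d * l := by nlinarith
  have hel : e * l ≤ d * l * (d * l) := by nlinarith
  by_contra! hcon
  have h1 : (2 * √g + d * l) * (2 * √g + 2 * d * l) ≤ (D - d * l) * D := by
    apply mul_le_mul <;> linarith
  nlinarith [mul_nonneg hs0 (zero_le_one.trans hdl)]

/-- Regret bounds of FlipFlop against a class of at least two experts, with constants that depend on
its parameters only. -/
theorem exists_flipFlop_regret_lt {α φ : ℝ} (hα : 0 < α) (hφ : 1 < φ) :
    ∃ C₀ C₁ C₂ C₃ : ℝ, 0 < C₀ ∧ 0 < C₁ ∧ 0 < C₂ ∧ 0 < C₃ ∧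
      ∀ {X : Type} (A : Finset X) (loss : ℕ → X → ℝ) (n : ℕ), 2 ≤ A.card → 1 ≤ n →
        (∀ t, 1 ≤ t → t ≤ n → ∀ x ∈ A, loss t x ∈ Set.Icc (0 : ℝ) 1) →
        ∑ k ∈ Finset.range n, flipFlopLoss α φ A loss k - bestLoss A loss n <
          min (C₀ * ftlRegret A loss n + C₁)
            (C₂ * √(bestLoss A loss n * ((n : ℝ) - bestLoss A loss n) / (n : ℝ)
                * Real.log (A.card : ℝ)) + C₃ * Real.log (A.card : ℝ)) := by
  have hφ' : 0 < φ - 1 := by linarith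
  obtain ⟨a, ha⟩ : ∃ a, a = 1 + α / (φ - 1) := ⟨_, rfl⟩
  obtain ⟨b, hb⟩ : ∃ b, b = 2 + φ / (φ - 1) := ⟨_, rfl⟩
  have ha0 : 0 < a := by rw [ha]; positivity
  have hb0 : 0 < b := by rw [hb]; positivity
  -- `R ≤ c Δ^flop + a`, from `Δ^flip ≤ (φ / α) Δ^flop + 1`
  obtain ⟨c, hc⟩ : ∃ c, c = a * (φ / α) + b := ⟨_, rfl⟩
  have hc0 : 0 < c := by rw [hc]; positivity
  -- `D = Δ^flop` satisfies `D ^ 2 ≤ 2 G ln |A| + d D ln |A| + 2 a ln |A|`, `G = L* (n - L*) / n`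
  obtain ⟨d, hd⟩ : ∃ d, d = 4 + 2 * c + 2 * a := ⟨_, rfl⟩
  refine ⟨a + b * α, b + 1, 2 * c, c * (2 * d) + 2 * a + 1, by positivity, by positivity,
    by positivity, by rw [hd]; positivity, ?_⟩
  intro X A loss n hA hn hl
  have hne : A.Nonempty := Finset.card_pos.1 (by omega)
  have hn0 : (0 : ℝ) < n := by exact_mod_cast hn
  have hbal := balanced_flipFlop hα hφ hA hl le_rfl
  have hreg := sum_flipFlopLoss_le hα hφ hA hl le_rfl
  have hftl := dFlip_le_ftlRegret (α := α) (φ := φ) (loss := loss) hne n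
  have hsq := dFlop_sq_le hα hφ hA hl le_rfl
  have hbest := bestLoss_mem_Icc hne hl
  rw [← ha, ← hb] at hreg
  have hlog2 : 1 / 2 < Real.log A.card := by
    have h2 := Real.log_two_gt_d9
    have : Real.log 2 ≤ Real.log A.card := Real.log_le_log two_pos (by exact_mod_cast hA)
    linarith
  have ho0 := hbal.dFlop_nonneg
  have hio := hbal.dFlip_le
  have hoi := hbal.dFlop_le
  set H := ∑ k ∈ Finset.range n, flipFlopLoss α φ A loss k with hH
  set di := (flipFlop α φ A loss n).dFlip
  set D := (flipFlop α φ A loss n).dFlop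
  set L := bestLoss A loss n
  set l := Real.log (A.card : ℝ)
  rw [lt_min_iff]
  constructor
  · have h1 : b * D ≤ b * (α * di + 1) := mul_le_mul_of_nonneg_left hoi hb0.le
    have h2 : (a + b * α) * di ≤ (a + b * α) * ftlRegret A loss n :=
      mul_le_mul_of_nonneg_left hftl (by positivity)
    linarith
  -- the estimate of the variances below needs a nonnegative regret
  · rcases lt_or_ge (H - L) 0 with hneg | hpos
    · refine hneg.trans_le ?_
      have : 0 ≤ c * (2 * d) + 2 * a + 1 := by rw [hd]; positivity
      have hl0 : 0 ≤ l := by linarith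
      positivity
    · have hR : H - L ≤ c * D + a := by
        have : a * di ≤ a * (φ / α * D + 1) := mul_le_mul_of_nonneg_left hio ha0.le
        rw [hc]
        linarith
      obtain ⟨G, hG⟩ : ∃ G, G = L * (n - L) / n := ⟨_, rfl⟩
      have hG0 : 0 ≤ G := by
        rw [hG]
        exact div_nonneg (mul_nonneg hbest.1 (sub_nonneg.2 hbest.2)) hn0.le
      have hV : ∑ k ∈ Finset.range n,
          flipFlopLoss α φ A loss k * (1 - flipFlopLoss α φ A loss k) ≤ G + (H - L) := by
        have hcs := sq_sum_le_card_mul_sum_sq (s := Finset.range n)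
          (f := flipFlopLoss α φ A loss)
        rw [Finset.card_range, ← hH] at hcs
        have h1 : ∑ k ∈ Finset.range n,
            flipFlopLoss α φ A loss k * (1 - flipFlopLoss α φ A loss k) =
            H - ∑ k ∈ Finset.range n, flipFlopLoss α φ A loss k ^ 2 := by
          rw [hH, ← Finset.sum_sub_distrib]
          exact Finset.sum_congr rfl fun k _ => by ring
        have h2 : H ^ 2 / n ≤ ∑ k ∈ Finset.range n, flipFlopLoss α φ A loss k ^ 2 := by
          rw [div_le_iff₀ hn0]; linarith
        have h3 : L ^ 2 / n ≤ H ^ 2 / n :=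
          div_le_div_of_nonneg_right (pow_le_pow_left₀ hbest.1 (by linarith) 2) hn0.le
        have h4 : G = L - L ^ 2 / n := by rw [hG]; field_simp
        rw [h1, h4]
        linarith
      rw [← hG]
      have hquad : D ^ 2 ≤ 2 * (G * l) + d * l * D + 2 * a * l := by
        have h1 : 2 * l * ∑ k ∈ Finset.range n,
            flipFlopLoss α φ A loss k * (1 - flipFlopLoss α φ A loss k) ≤
            2 * l * (G + (c * D + a)) := by
          refine mul_le_mul_of_nonneg_left (hV.trans (by linarith)) (by linarith)
        have h2 : D ≤ 2 * l * D := le_mul_of_one_le_left ho0 (by linarith)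
        have h3 : 0 ≤ a * (l * D) := mul_nonneg ha0.le (mul_nonneg (by linarith) ho0)
        rw [hd]
        linarith
      have hGl : 0 ≤ G * l := mul_nonneg hG0 (by linarith)
      have hD : D ≤ 2 * √(G * l) + 2 * d * l :=
        le_sqrt_of_sq_le hGl hlog2 (by rw [hd]; linarith) (by rw [hd]; linarith) hquad
      have : c * D ≤ c * (2 * √(G * l) + 2 * d * l) := mul_le_mul_of_nonneg_left hD hc0.le
      have hal : a < (2 * a + 1) * l := by nlinarith
      linarith

/-! ### The first alive expert of an ordering -/

section FirstAlive

variable {K : ℕ} [NeZero K] {S E : Finset (Fin K)} {π : PermExpert K} {i i' j : Fin K}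

lemma firstAlive_eq_iff (hS : S.Nonempty) :
    firstAlive S π = i ↔ i ∈ S ∧ ∀ k ∈ S, π.symm i ≤ π.symm k := by
  have hne : (Finset.univ.filter fun k => π k ∈ S).Nonempty := by
    obtain ⟨k, hk⟩ := hS
    exact ⟨π.symm k, by simpa using hk⟩
  rw [firstAlive, dif_pos hne]
  have hmem : π ((Finset.univ.filter fun k => π k ∈ S).min' hne) ∈ S :=
    (Finset.mem_filter.1 (Finset.min'_mem _ hne)).2
  have hle : ∀ k ∈ S, (Finset.univ.filter fun k => π k ∈ S).min' hne ≤ π.symm k := fun k hk =>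
    Finset.min'_le _ _ (by simpa using hk)
  constructor
  · rintro rfl
    exact ⟨hmem, fun k hk => by simpa using hle k hk⟩
  · rintro ⟨hi, h⟩
    have h1 := h _ hmem
    rw [Equiv.symm_apply_apply] at h1
    rw [le_antisymm (hle i hi) h1, Equiv.apply_symm_apply]

lemma firstAlive_mem (hS : S.Nonempty) (π : PermExpert K) : firstAlive S π ∈ S :=
  ((firstAlive_eq_iff hS).1 rfl).1

lemma firstAlive_of_subset (h : E ⊆ S) (hmem : firstAlive S π ∈ E) :
    firstAlive E π = firstAlive S π := by
  rw [firstAlive_eq_iff ⟨_, hmem⟩]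
  exact ⟨hmem, fun k hk => ((firstAlive_eq_iff ⟨k, h hk⟩).1 rfl).2 k (h hk)⟩

lemma firstAlive_erase_eq_iff (hi : i ∈ E.erase j) :
    firstAlive (E.erase j) π = i ↔
      firstAlive E π = i ∨ firstAlive E π = j ∧ firstAlive (E.erase j) π = i := by
  constructor
  · intro h
    by_cases hj : firstAlive E π = j
    · exact Or.inr ⟨hj, h⟩
    · have hmem : firstAlive E π ∈ E.erase j :=
        Finset.mem_erase.2 ⟨hj, firstAlive_mem ⟨i, Finset.mem_of_mem_erase hi⟩ π⟩
      exact Or.inl ((firstAlive_of_subset (Finset.erase_subset _ _) hmem).symm.trans h)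
  · rintro (h | h)
    · rw [firstAlive_of_subset (Finset.erase_subset _ _) (h ▸ hi), h]
    · exact h.2

lemma firstAlive_trans_swap (hi : i ∈ S) (hi' : i' ∈ S) :
    firstAlive S (π.trans (Equiv.swap i i')) = Equiv.swap i i' (firstAlive S π) := by
  have hmaps : ∀ k ∈ S, Equiv.swap i i' k ∈ S := fun k hk => by
    rw [Equiv.swap_apply_def]; split_ifs <;> assumption
  obtain ⟨hmem, hle⟩ := (firstAlive_eq_iff (π := π) ⟨i, hi⟩).1 rfl
  rw [firstAlive_eq_iff ⟨i, hi⟩]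
  refine ⟨hmaps _ hmem, fun k hk => ?_⟩
  simpa using hle _ (hmaps k hk)

/-- An ordering that now plays `j` has never played an expert that is still alive and differs from
`j`, so exchanging two such experts does not change its past. -/
lemma firstAlive_trans_swap_of_subset (hj : firstAlive E π = j) (hi : i ∈ E.erase j)
    (hi' : i' ∈ E.erase j) (hS : E ⊆ S) :
    firstAlive S (π.trans (Equiv.swap i i')) = firstAlive S π := by
  have hne : ∀ k ∈ E.erase j, firstAlive S π ≠ k := by
    rintro k hk rfl
    exact Finset.ne_of_mem_erase hk
      ((firstAlive_of_subset hS (Finset.mem_of_mem_erase hk)).symm.trans hj)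
  rw [firstAlive_trans_swap (hS (Finset.mem_of_mem_erase hi)) (hS (Finset.mem_of_mem_erase hi')),
    Equiv.swap_apply_of_ne_of_ne (hne i hi) (hne i' hi')]

end FirstAlive

/-! ### Splitting the weight of a dying expert -/

section Splits

variable {K : ℕ} [NeZero K]

/-- `F π` depends only on what the ordering `π` plays while the set of alive experts is one of the
supersets of `E` in `fam`. -/
def DependsOnPast (fam : Finset (Fin K) → Prop) (E : Finset (Fin K)) (F : PermExpert K → ℝ) :
    Prop :=
  ∀ π ρ, (∀ S, fam S → E ⊆ S → firstAlive S π = firstAlive S ρ) → F π = F ρ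

lemma DependsOnPast.mono {fam : Finset (Fin K) → Prop} {E E' : Finset (Fin K)}
    {F : PermExpert K → ℝ} (hF : DependsOnPast fam E F) (h : E' ⊆ E) : DependsOnPast fam E' F :=
  fun π ρ hπ => hF π ρ fun S hS hE => hπ S hS (h.trans hE)

lemma DependsOnPast.comp {fam : Finset (Fin K) → Prop} {E : Finset (Fin K)}
    {F : PermExpert K → ℝ} (hF : DependsOnPast fam E F) (g : ℝ → ℝ) :
    DependsOnPast fam E fun π => g (F π) :=
  fun π ρ h => congrArg g (hF π ρ h)

/-- The rule `R` describes the orderings in `A`, as long as the sets of alive experts belong to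
`fam`: its initial coefficients count the orderings by their first expert, and when expert `j`
dies, its shares are the proportions in which the orderings that play `j` move to the remaining
experts, whatever these orderings played in the past. -/
structure Splits (R : Rule K) (A : Finset (PermExpert K)) (fam : Finset (Fin K) → Prop) :
    Prop where
  init_eq : ∀ i, R.init i = ((A.filter fun π => firstAlive Finset.univ π = i).card : ℝ)
  init_pos : ∀ i, 0 < R.init i
  share_pos : ∀ E j i, fam E → j ∈ E → fam (E.erase j) → i ∈ E.erase j →
    0 < R.share (E.erase j) j i
  split : ∀ E j i F, fam E → j ∈ E → fam (E.erase j) → i ∈ E.erase j → DependsOnPast fam E F →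
    ∑ π ∈ A with firstAlive E π = j ∧ firstAlive (E.erase j) π = i, F π =
      R.share (E.erase j) j i * ∑ π ∈ A with firstAlive E π = j, F π

variable {R : Rule K} {A : Finset (PermExpert K)} {fam : Finset (Fin K) → Prop}

lemma Splits.sum_init (hR : Splits R A fam) : ∑ i, R.init i = A.card := by
  rw [Finset.card_eq_sum_card_fiberwise (f := firstAlive Finset.univ) (t := Finset.univ)
    fun _ _ => Finset.mem_coe.2 (Finset.mem_univ _)]
  push_cast
  exact Finset.sum_congr rfl fun i _ => hR.init_eq i

lemma Splits.nonempty (hR : Splits R A fam) : A.Nonempty := by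
  have h := hR.init_pos 0
  rw [hR.init_eq] at h
  exact (Finset.card_pos.1 (by exact_mod_cast h)).mono (Finset.filter_subset _ _)

lemma Splits.sum_erase (hR : Splits R A fam) {E : Finset (Fin K)} {j i : Fin K}
    {F : PermExpert K → ℝ} (hE : fam E) (hj : j ∈ E) (hE' : fam (E.erase j)) (hi : i ∈ E.erase j)
    (hF : DependsOnPast fam E F) :
    ∑ π ∈ A with firstAlive (E.erase j) π = i, F π =
      ∑ π ∈ A with firstAlive E π = i, F π +
        R.share (E.erase j) j i * ∑ π ∈ A with firstAlive E π = j, F π := by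
  rw [← hR.split E j i F hE hj hE' hi hF, ← Finset.sum_union]
  · refine Finset.sum_congr ?_ fun _ _ => rfl
    ext π
    simp only [Finset.mem_filter, Finset.mem_union, ← and_or_left]
    rw [← firstAlive_erase_eq_iff hi]
  · rw [Finset.disjoint_filter]
    rintro π - h ⟨h', -⟩
    exact Finset.ne_of_mem_erase hi (h.symm.trans h')

/-- The coefficients `h i * c i` are the total weights `F` of the orderings that play `i`. -/
def HCState.Represents (s : HCState K) (A : Finset (PermExpert K)) (F : PermExpert K → ℝ)
    (E : Finset (Fin K)) : Prop :=
  s.alive = E ∧ ∀ i ∈ E, s.h i * s.c i = ∑ π ∈ A with firstAlive E π = i, F π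

lemma HCState.Represents.die (hR : Splits R A fam) {s : HCState K} {F : PermExpert K → ℝ}
    {E : Finset (Fin K)} {j : Fin K} (hE : fam E) (hj : j ∈ E) (hE' : fam (E.erase j))
    (hF : DependsOnPast fam E F) (hs : s.Represents A F E) :
    (s.die R j).Represents A F (E.erase j) := by
  obtain ⟨rfl, hs⟩ := hs
  refine ⟨rfl, fun i hi => ?_⟩
  simp only [HCState.die]
  rw [if_pos hi, if_pos hi, mul_one, hR.sum_erase hE hj hE' hi hF,
    hs i (Finset.mem_of_mem_erase hi), hs j hj, mul_comm (R.share _ _ _)]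

lemma HCState.Represents.receive {s : HCState K} {F : PermExpert K → ℝ}
    {E : Finset (Fin K)} (hs : s.Represents A F E) (η : ℝ) (l : Fin K → ℝ) :
    (s.receive η l).Represents A (fun π => F π * Real.exp (-η * l (firstAlive E π))) E := by
  obtain ⟨rfl, hs⟩ := hs
  refine ⟨rfl, fun i hi => ?_⟩
  simp only [HCState.receive]
  rw [← mul_assoc, hs i hi, Finset.sum_mul]
  refine Finset.sum_congr rfl fun π hπ => ?_
  rw [(Finset.mem_filter.1 hπ).2]

/-- `s.L i` is the least of the losses `L` of the orderings that play `i`, and `s.mult i` is the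
number of these orderings that attain it. -/
def FTLState.Represents (s : FTLState K) (A : Finset (PermExpert K)) (L : PermExpert K → ℝ)
    (E : Finset (Fin K)) : Prop :=
  s.alive = E ∧ ∀ i ∈ E, (∀ π ∈ A, firstAlive E π = i → s.L i ≤ L π) ∧
    s.mult i = (∑ π ∈ A with firstAlive E π = i, if L π = s.L i then 1 else 0) ∧ 0 < s.mult i

lemma FTLState.Represents.die (hR : Splits R A fam) {s : FTLState K} {L : PermExpert K → ℝ}
    {E : Finset (Fin K)} {j : Fin K} (hE : fam E) (hj : j ∈ E) (hE' : fam (E.erase j))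
    (hL : DependsOnPast fam E L) (hs : s.Represents A L E) :
    (s.die R j).Represents A L (E.erase j) := by
  obtain ⟨rfl, hs⟩ := hs
  refine ⟨rfl, fun i hi => ?_⟩
  obtain ⟨hjle, hjm, hj0⟩ := hs j hj
  obtain ⟨hile, him, hi0⟩ := hs i (Finset.mem_of_mem_erase hi)
  have hsh := hR.share_pos _ j i hE hj hE' hi
  -- values below the minimum are not attained
  have hzero : ∀ k v, (∀ π ∈ A, firstAlive s.alive π = k → s.L k ≤ L π) → v < s.L k →
      ∑ π ∈ A with firstAlive s.alive π = k, (if L π = v then (1 : ℝ) else 0) = 0 := by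
    intro k v hk hv
    refine Finset.sum_eq_zero fun π hπ => if_neg ?_
    rw [Finset.mem_filter] at hπ
    exact (hv.trans_le (hk π hπ.1 hπ.2)).ne'
  have hcount : ∀ v, ∑ π ∈ A with firstAlive (s.alive.erase j) π = i,
      (if L π = v then (1 : ℝ) else 0) = _ := fun v =>
    hR.sum_erase hE hj hE' hi (hL.comp fun x => if x = v then (1 : ℝ) else 0)
  have hle : ∀ v, v ≤ s.L i → v ≤ s.L j → ∀ π ∈ A, firstAlive (s.alive.erase j) π = i →
      v ≤ L π := by
    intro v hvi hvj π hπ h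
    rcases (firstAlive_erase_eq_iff hi).1 h with h | ⟨h, -⟩
    · exact hvi.trans (hile π hπ h)
    · exact hvj.trans (hjle π hπ h)
  simp only [FTLState.die, hi, true_and, if_true]
  rcases lt_trichotomy (s.L j) (s.L i) with h | h | h
  · simp only [h, if_true]
    refine ⟨hle _ h.le le_rfl, ?_, mul_pos hj0 hsh⟩
    rw [hcount, hzero i _ hile h, zero_add, ← hjm, mul_comm]
  · simp only [h, lt_irrefl, if_true, if_false]
    refine ⟨hle _ le_rfl h.ge, ?_, by positivity⟩
    rw [hcount, ← him, ← h, ← hjm, mul_comm (s.mult j)]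
  · simp only [h.not_gt, h.ne', if_false]
    refine ⟨hle _ le_rfl h.le, ?_, hi0⟩
    rw [hcount, ← him, hzero j _ hjle h, mul_zero, add_zero]

lemma FTLState.Represents.receive {s : FTLState K} {L : PermExpert K → ℝ}
    {E : Finset (Fin K)} (hs : s.Represents A L E) (l : Fin K → ℝ) :
    (s.receive l).Represents A (fun π => L π + l (firstAlive E π)) E := by
  obtain ⟨rfl, hs⟩ := hs
  refine ⟨rfl, fun i hi => ?_⟩
  obtain ⟨hle, hm, h0⟩ := hs i hi
  refine ⟨fun π hπ h => ?_, ?_, h0⟩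
  · simp only [FTLState.receive, h]
    linarith [hle π hπ h]
  · simp only [FTLState.receive]
    rw [hm]
    refine Finset.sum_congr rfl fun π hπ => ?_
    simp only [(Finset.mem_filter.1 hπ).2, add_left_inj]

lemma FTLState.Represents.best_eq {s : FTLState K} {L : PermExpert K → ℝ}
    {E : Finset (Fin K)} (hs : s.Represents A L E) (hA : A.Nonempty) (hE : E.Nonempty) :
    s.best = finMin A L := by
  obtain ⟨rfl, hs⟩ := hs
  refine le_antisymm (le_finMin hA fun π hπ => ?_) (le_finMin hE fun i hi => ?_)
  · have hmem := firstAlive_mem hE π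
    exact (finMin_le hmem).trans ((hs _ hmem).1 π hπ rfl)
  · obtain ⟨-, hm, h0⟩ := hs i hi
    obtain ⟨π, hπ, h⟩ := Finset.exists_ne_zero_of_sum_ne_zero (hm.symm.trans_ne h0.ne')
    rw [Finset.mem_filter] at hπ
    have : L π = s.L i := by
      by_contra hc
      exact h (if_neg hc)
    rw [← this]
    exact finMin_le hπ.1

end Splits

/-! ### Simulation of FlipFlop over a set of orderings -/

section Simulation

variable {K T : ℕ} [NeZero K] {G : Game K T} {R : Rule K} {A : Finset (PermExpert K)}
  {fam : Finset (Fin K) → Prop}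

omit [NeZero K] in
/-- An invariant that survives every single death survives the deaths of a night. -/
lemma foldl_deaths {σ : Type*} {step : σ → Fin K → σ} {P : σ → Finset (Fin K) → Prop}
    (hstep : ∀ s E j, fam E → j ∈ E → fam (E.erase j) → P s E → P (step s j) (E.erase j)) :
    ∀ (l : List (Fin K)) (s : σ) (E : Finset (Fin K)), l.Nodup → (∀ j ∈ l, j ∈ E) →
      (∀ k ≤ l.length, fam (E \ (l.take k).toFinset)) → P s E →
      P (l.foldl step s) (E \ l.toFinset)
  | [], s, E, _, _, _, hP => by simpa using hP
  | j :: l, s, E, hnd, hmem, hfam, hP => by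
    rw [List.nodup_cons] at hnd
    have herase : ∀ l' : List (Fin K), E \ (j :: l').toFinset = E.erase j \ l'.toFinset := by
      intro l'
      ext x
      simp only [Finset.mem_sdiff, List.mem_toFinset, List.mem_cons, Finset.mem_erase]
      tauto
    rw [herase, List.foldl_cons]
    have h0 := hfam 0 (Nat.zero_le _)
    have h1 := hfam 1 (by simp)
    simp only [List.take_zero, List.toFinset_nil, Finset.sdiff_empty] at h0
    rw [List.take_succ_cons, List.take_zero, herase] at h1
    simp only [List.toFinset_nil, Finset.sdiff_empty] at h1
    refine foldl_deaths hstep l _ _ hnd.2 (fun i hi => ?_) (fun k hk => ?_)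
      (hstep s E j h0 (hmem j (by simp)) h1 hP)
    · exact Finset.mem_erase.2 ⟨fun h => hnd.1 (h ▸ hi), hmem i (by simp [hi])⟩
    · have := hfam (k + 1) (by simpa using hk)
      rwa [List.take_succ_cons, herase] at this

namespace Game

/-- All sets of alive experts that occur in the game, dummy rounds included, belong to `fam`. -/
structure Within (G : Game K T) (fam : Finset (Fin K) → Prop) : Prop where
  alive : ∀ t, 1 ≤ t → t ≤ T → fam (G.alive t)
  dummy : ∀ t, 1 ≤ t → t < T → ∀ k ≤ (G.deaths t).length,
    fam (G.alive t \ ((G.deaths t).take k).toFinset)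

omit [NeZero K] in
lemma alive_subset (G : Game K T) {s t : ℕ} (hs : 1 ≤ s) (hst : s ≤ t) (ht : t ≤ T) :
    G.alive t ⊆ G.alive s := by
  induction t, hst using Nat.le_induction with
  | base => exact Finset.Subset.refl _
  | succ t hst ih =>
    exact (G.alive_anti t (hs.trans hst) (by omega)).trans (ih (by omega))

omit [NeZero K] in
lemma mem_deaths {t : ℕ} {i : Fin K} :
    i ∈ G.deaths t ↔ i ∈ G.alive t ∧ i ∉ G.alive (t + 1) := by
  simp [Game.deaths]

omit [NeZero K] in
lemma alive_sdiff_deaths {t : ℕ} (ht : 1 ≤ t) (htT : t < T) :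
    G.alive t \ (G.deaths t).toFinset = G.alive (t + 1) := by
  have h := G.alive_anti t ht htT
  ext i
  simp only [Finset.mem_sdiff, List.mem_toFinset, mem_deaths]
  have := @h i
  tauto

omit [NeZero K] in
/-- A night preserves an invariant if every single death does. -/
lemma foldl_deaths_alive (hG : G.Within fam) {σ : Type*} {step : σ → Fin K → σ}
    {P : σ → Finset (Fin K) → Prop} {t : ℕ} (ht : 1 ≤ t) (htT : t < T)
    (hstep : ∀ s E j, E ⊆ G.alive t → fam E → j ∈ E → fam (E.erase j) → P s E →
      P (step s j) (E.erase j)) {s : σ} (hs : P s (G.alive t)) :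
    P ((G.deaths t).foldl step s) (G.alive (t + 1)) := by
  have h := foldl_deaths (fam := fam) (step := step) (P := fun s E => E ⊆ G.alive t ∧ P s E)
    (fun s E j hE hj hE' h =>
      ⟨(Finset.erase_subset _ _).trans h.1, hstep s E j h.1 hE hj hE' h.2⟩)
    (G.deaths t) s (G.alive t) (Finset.sort_nodup _ _) (fun j hj => (mem_deaths.1 hj).1)
    (hG.dummy t ht htT) ⟨Finset.Subset.refl _, hs⟩
  rw [alive_sdiff_deaths ht htT] at h
  exact h.2

lemma dependsOnPast_cumLoss (hG : G.Within fam) {n : ℕ} (hn : n ≤ T) :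
    DependsOnPast fam (G.alive n) (cumLoss G.permLoss n) := by
  intro π ρ h
  refine Finset.sum_congr rfl fun s hs => ?_
  rw [Finset.mem_Icc] at hs
  rw [Game.permLoss, Game.permLoss, Game.sigma, Game.sigma,
    h _ (hG.alive s hs.1 (hs.2.trans hn)) (G.alive_subset hs.1 hs.2 hn)]

lemma hcRun_represents (hR : Splits R A fam) (hG : G.Within fam) (η : ℝ) {n : ℕ} (hn : n < T) :
    (G.hcRun R η n).Represents A (fun π => Real.exp (-η * cumLoss G.permLoss n π))
      (G.alive (n + 1)) := by
  induction n with
  | zero =>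
    rw [zero_add, G.alive_one]
    exact ⟨rfl, fun i _ => by simp [Game.hcRun, cumLoss_zero, hR.init_eq]⟩
  | succ n ih =>
    have h1 := (ih (by omega)).receive η (G.loss (n + 1))
    have h2 : (fun π => Real.exp (-η * cumLoss G.permLoss n π) *
        Real.exp (-η * G.loss (n + 1) (firstAlive (G.alive (n + 1)) π))) =
        fun π => Real.exp (-η * cumLoss G.permLoss (n + 1) π) := by
      funext π
      rw [cumLoss_succ, mul_add, Real.exp_add]
      rfl
    rw [h2] at h1
    refine foldl_deaths_alive hG (P := fun s E => HCState.Represents s A _ E) (by omega) hn ?_ h1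
    intro s E j hsub hE hj hE' hs
    exact hs.die hR hE hj hE' (((dependsOnPast_cumLoss hG hn.le).mono hsub).comp
      fun x => Real.exp (-η * x))

lemma receive_ftlRun_represents {n : ℕ} {s : FTLState K}
    (hs : s.Represents A (cumLoss G.permLoss n) (G.alive (n + 1))) :
    (s.receive (G.loss (n + 1))).Represents A (cumLoss G.permLoss (n + 1)) (G.alive (n + 1)) := by
  have h2 : cumLoss G.permLoss (n + 1) = fun π => cumLoss G.permLoss n π +
      G.loss (n + 1) (firstAlive (G.alive (n + 1)) π) := by
    funext π
    rw [cumLoss_succ]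
    rfl
  rw [h2]
  exact hs.receive _

lemma ftlRun_represents (hR : Splits R A fam) (hG : G.Within fam) {n : ℕ} (hn : n < T) :
    (G.ftlRun R n).Represents A (cumLoss G.permLoss n) (G.alive (n + 1)) := by
  induction n with
  | zero =>
    rw [zero_add, G.alive_one]
    refine ⟨rfl, fun i _ => ⟨fun π _ _ => by simp [Game.ftlRun, cumLoss_zero], ?_,
      hR.init_pos i⟩⟩
    simp [Game.ftlRun, cumLoss_zero, hR.init_eq]
  | succ n ih =>
    refine foldl_deaths_alive hG (P := fun s E => FTLState.Represents s A _ E) (by omega) hn ?_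
      (receive_ftlRun_represents (ih (by omega)))
    intro s E j hsub hE hj hE' hs
    exact hs.die hR hE hj hE' ((dependsOnPast_cumLoss hG hn.le).mono hsub)

variable (hR : Splits R A fam) (hG : G.Within fam) {n : ℕ} (hn : n < T)
include hR hG hn

lemma algBest_eq : G.algBest R n = bestLoss A G.permLoss n :=
  (ftlRun_represents hR hG hn).best_eq hR.nonempty (G.alive_nonempty _ (by omega) hn)

lemma algBestNext_eq : G.algBestNext R n = bestLoss A G.permLoss (n + 1) :=
  (receive_ftlRun_represents (ftlRun_represents hR hG hn)).best_eq hR.nonempty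
    (G.alive_nonempty _ (by omega) hn)

lemma algWeight_eq (η : WithTop ℝ) {i : Fin K} (hi : i ∈ G.alive (n + 1)) :
    G.algWeight R n η i =
      ∑ π ∈ A with G.sigma (n + 1) π = i, hedgeWeight A G.permLoss n η π := by
  induction η using WithTop.recTopCoe with
  | top =>
    obtain ⟨hle, hm, -⟩ := (ftlRun_represents hR hG hn).2 i hi
    have hb := algBest_eq hR hG hn
    simp only [Game.algWeight, hedgeWeight]
    split_ifs with h
    · rw [hm, h, hb]
      rfl
    · refine (Finset.sum_eq_zero fun π hπ => if_neg fun hc => h ?_).symm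
      rw [Finset.mem_filter] at hπ
      refine le_antisymm ((hle π hπ.1 hπ.2).trans (hc.le.trans hb.ge)) (finMin_le ?_)
      rwa [(ftlRun_represents hR hG hn).1]
  | coe η => exact (hcRun_represents hR hG η hn).2 i hi

lemma algProb_eq (η : WithTop ℝ) (i : Fin K) :
    G.algProb R n η i =
      ∑ π ∈ A with G.sigma (n + 1) π = i, hedgeProb A G.permLoss n η π := by
  have hmem : ∀ π, G.sigma (n + 1) π ∈ G.alive (n + 1) :=
    firstAlive_mem (G.alive_nonempty _ (by omega) hn)
  rw [Game.algProb]
  split_ifs with hi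
  · simp only [hedgeProb]
    rw [← Finset.sum_div, algWeight_eq hR hG hn η hi]
    congr 1
    rw [← Finset.sum_fiberwise_of_maps_to fun π _ => hmem π]
    exact Finset.sum_congr rfl fun j hj => algWeight_eq hR hG hn η hj
  · rw [Finset.filter_false_of_mem, Finset.sum_empty]
    rintro π - rfl
    exact hi (hmem π)

lemma sum_algProb_mul (η : WithTop ℝ) (f : Fin K → ℝ) :
    ∑ i, G.algProb R n η i * f i =
      ∑ π ∈ A, hedgeProb A G.permLoss n η π * f (G.sigma (n + 1) π) := by
  rw [← Finset.sum_fiberwise A (G.sigma (n + 1))]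
  refine Finset.sum_congr rfl fun i _ => ?_
  rw [algProb_eq hR hG hn, Finset.sum_mul]
  refine Finset.sum_congr rfl fun π hπ => ?_
  rw [(Finset.mem_filter.1 hπ).2]

lemma algLossAt_eq (η : WithTop ℝ) : G.algLossAt R n η = hedgeLoss A G.permLoss n η :=
  sum_algProb_mul hR hG hn η _

lemma algMixLoss_eq (η : WithTop ℝ) : G.algMixLoss R n η = hedgeMixLoss A G.permLoss n η := by
  induction η using WithTop.recTopCoe with
  | top =>
    simp only [Game.algMixLoss, hedgeMixLoss]
    rw [algBest_eq hR hG hn, algBestNext_eq hR hG hn]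
  | coe η =>
    simp only [Game.algMixLoss, hedgeMixLoss]
    rw [sum_algProb_mul hR hG hn η fun i => Real.exp (-η * G.loss (n + 1) i)]
    rfl

omit hn in
lemma algState_eq (α φ : ℝ) (hn : n ≤ T) :
    G.algState R α φ n = flipFlop α φ A G.permLoss n := by
  induction n with
  | zero => rfl
  | succ n ih =>
    simp only [Game.algState, flipFlop]
    rw [ih (by omega), hR.sum_init, algLossAt_eq hR hG hn, algMixLoss_eq hR hG hn]

lemma algRate_eq (α φ : ℝ) : G.algRate R α φ n = flipFlopRate α φ A G.permLoss n := by
  rw [Game.algRate, algState_eq hR hG α φ hn.le, hR.sum_init]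
  rfl

omit hn in
theorem simulates (α φ : ℝ) : G.Simulates R α φ A := by
  refine ⟨fun n hn => algState_eq hR hG α φ hn, fun n hn => ?_⟩
  have hrate := algRate_eq hR hG hn α φ
  refine ⟨hrate, fun i hi => ?_, fun i => ?_, algBest_eq hR hG hn, algBestNext_eq hR hG hn⟩
  · rw [hrate]
    exact algWeight_eq hR hG hn _ hi
  · rw [Game.algPlay, hrate]
    exact algProb_eq hR hG hn _ i

omit hn in
lemma algRegret_eq (α φ : ℝ) (hn : n ≤ T) : G.algRegret R α φ A n =
    ∑ k ∈ Finset.range n, flipFlopLoss α φ A G.permLoss k - bestLoss A G.permLoss n := by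
  rw [Game.algRegret]
  congr 1
  refine Finset.sum_congr rfl fun k hk => ?_
  have hk' : k < T := (Finset.mem_range.1 hk).trans_le hn
  simp only [Game.algPlay, algRate_eq hR hG hk' α φ]
  exact algLossAt_eq hR hG hk' _

end Game

end Simulation

/-! ### All orderings: Hedge-Perm-Unknown -/

section Unknown

variable {K : ℕ} [NeZero K]

lemma sum_firstAlive_erase_eq {E : Finset (Fin K)} {j i i' : Fin K} {F : PermExpert K → ℝ}
    (hi : i ∈ E.erase j) (hi' : i' ∈ E.erase j) (hF : DependsOnPast (fun _ => True) E F) :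
    ∑ π with firstAlive E π = j ∧ firstAlive (E.erase j) π = i, F π =
      ∑ π with firstAlive E π = j ∧ firstAlive (E.erase j) π = i', F π := by
  have hinv : ∀ π : PermExpert K,
      (π.trans (Equiv.swap i i')).trans (Equiv.swap i i') = π := fun π => by
    ext k; simp
  refine Finset.sum_nbij' (fun π => π.trans (Equiv.swap i i'))
    (fun π => π.trans (Equiv.swap i i')) ?_ ?_ (fun π _ => hinv π) (fun π _ => hinv π) ?_
  · intro π hπ
    simp only [Finset.mem_filter, Finset.mem_univ, true_and] at hπ ⊢
    rw [firstAlive_trans_swap_of_subset hπ.1 hi hi' (Finset.Subset.refl _),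
      firstAlive_trans_swap hi hi', hπ.2, Equiv.swap_apply_left]
    exact ⟨hπ.1, rfl⟩
  · intro π hπ
    simp only [Finset.mem_filter, Finset.mem_univ, true_and] at hπ ⊢
    rw [firstAlive_trans_swap_of_subset hπ.1 hi hi' (Finset.Subset.refl _),
      firstAlive_trans_swap hi hi', hπ.2, Equiv.swap_apply_right]
    exact ⟨hπ.1, rfl⟩
  · intro π hπ
    simp only [Finset.mem_filter, Finset.mem_univ, true_and] at hπ
    exact hF _ _ fun S _ hS => (firstAlive_trans_swap_of_subset hπ.1 hi hi' hS).symm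

lemma card_firstAlive_univ_eq (i : Fin K) :
    (Finset.univ.filter fun π : PermExpert K => firstAlive Finset.univ π = i).card =
      (K - 1).factorial := by
  have hconst : ∀ i' : Fin K,
      (Finset.univ.filter fun π : PermExpert K => firstAlive Finset.univ π = i').card =
      (Finset.univ.filter fun π : PermExpert K => firstAlive Finset.univ π = i).card := by
    intro i'
    have hinv : ∀ π : PermExpert K,
        (π.trans (Equiv.swap i i')).trans (Equiv.swap i i') = π := fun π => by
      ext k; simp
    refine Finset.card_nbij' (fun π => π.trans (Equiv.swap i i'))
      (fun π => π.trans (Equiv.swap i i')) ?_ ?_ (fun π _ => hinv π) (fun π _ => hinv π) <;>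
    · intro π hπ
      simp only [Finset.coe_filter, Finset.mem_univ, true_and, Set.mem_ofPred_eq] at hπ ⊢
      rw [firstAlive_trans_swap (Finset.mem_univ _) (Finset.mem_univ _), hπ]
      simp
  have hsum := Finset.card_eq_sum_card_fiberwise (s := (Finset.univ : Finset (PermExpert K)))
    (f := firstAlive Finset.univ) (t := Finset.univ) fun _ _ => Finset.mem_coe.2 (Finset.mem_univ _)
  rw [Finset.sum_congr rfl fun i' _ => hconst i', Finset.sum_const, Finset.card_univ,
    Fintype.card_perm, Finset.card_univ, Fintype.card_fin, smul_eq_mul,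
    ← Nat.mul_factorial_pred (NeZero.ne K)] at hsum
  exact (Nat.eq_of_mul_eq_mul_left (NeZero.pos K) hsum).symm

/-- By symmetry, the orderings that play a dying expert move to each of the remaining experts in
equal proportions. -/
theorem splits_hpu : Splits (hpu K) Finset.univ fun _ => True where
  init_eq i := by rw [card_firstAlive_univ_eq]; rfl
  init_pos i := by simp only [hpu]; exact_mod_cast Nat.factorial_pos _
  share_pos E j i _ _ _ hi := by
    simp only [hpu]
    have : 0 < (E.erase j).card := Finset.card_pos.2 ⟨i, hi⟩
    positivity
  split E j i F _ _ _ hi hF := by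
    have hcard : ((E.erase j).card : ℝ) ≠ 0 := by exact_mod_cast (Finset.card_pos.2 ⟨i, hi⟩).ne'
    have hsum : ∑ π with firstAlive E π = j, F π = ∑ i' ∈ E.erase j,
        ∑ π with firstAlive E π = j ∧ firstAlive (E.erase j) π = i', F π := by
      rw [← Finset.sum_fiberwise_of_maps_to (t := E.erase j) (g := firstAlive (E.erase j))
        fun π _ => firstAlive_mem ⟨i, hi⟩ π]
      exact Finset.sum_congr rfl fun i' _ => by rw [Finset.filter_filter]
    rw [hsum, Finset.sum_congr rfl fun i' hi' => sum_firstAlive_erase_eq hi' hi hF,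
      Finset.sum_const, nsmul_eq_mul]
    simp only [hpu]
    field_simp

end Unknown

/-! ### Effective orderings: Hedge-Perm-Known -/

section Known

variable {K : ℕ}

/-- The experts `d, d + 1, …, K - 1`, which are alive when `0, …, d - 1` have died. -/
def tailSet (K d : ℕ) : Finset (Fin K) := Finset.univ.filter fun i => d ≤ (i : ℕ)

lemma mem_tailSet {d : ℕ} {i : Fin K} : i ∈ tailSet K d ↔ d ≤ (i : ℕ) := by simp [tailSet]

lemma tailSet_zero : tailSet K 0 = Finset.univ := by ext; simp [mem_tailSet]

lemma tailSet_nonempty {d : ℕ} (hd : d < K) : (tailSet K d).Nonempty :=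
  ⟨⟨d, hd⟩, mem_tailSet.2 le_rfl⟩

lemma tailSet_anti {d d' : ℕ} (h : d ≤ d') : tailSet K d' ⊆ tailSet K d := fun _ hi =>
  mem_tailSet.2 (h.trans (mem_tailSet.1 hi))

lemma tailSet_erase {d : ℕ} (hd : d < K) : (tailSet K d).erase ⟨d, hd⟩ = tailSet K (d + 1) := by
  ext i
  rw [Finset.mem_erase, mem_tailSet, mem_tailSet, Ne, Fin.ext_iff]
  simp only
  omega

lemma card_tailSet (d : ℕ) : (tailSet K d).card = K - d := by
  rcases lt_or_ge d K with hd | hd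
  · have : tailSet K d = Finset.Ici ⟨d, hd⟩ := by
      ext i; rw [mem_tailSet, Finset.mem_Ici, Fin.le_def]
    rw [this, Fin.card_Ici]
  · rw [Finset.card_eq_zero.2, Nat.sub_eq_zero_of_le hd]
    ext i
    simp only [mem_tailSet, Finset.notMem_empty, iff_false]
    omega

/-- An up-closed set of experts is determined by its cardinality. -/
lemma eq_tailSet {E : Finset (Fin K)} (h : ∀ i j, i < j → i ∈ E → j ∈ E) :
    E = tailSet K (K - E.card) := by
  rcases E.eq_empty_or_nonempty with rfl | hE
  · ext i; simp [mem_tailSet]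
  · have hEa : E = tailSet K (E.min' hE) := by
      ext i
      rw [mem_tailSet, ← Fin.le_def]
      refine ⟨fun hi => E.min'_le i hi, fun hi => ?_⟩
      rcases hi.eq_or_lt with hi | hi
      · exact hi ▸ E.min'_mem hE
      · exact h _ _ hi (E.min'_mem hE)
    have hcard : E.card = K - (E.min' hE : ℕ) := by
      conv_lhs => rw [hEa]
      exact card_tailSet _
    have := (E.min' hE).isLt
    rw [show K - E.card = (E.min' hE : ℕ) by omega]
    exact hEa

lemma startCount_pos {m : ℕ} (hm : m < K) (i : Fin K) : 0 < startCount K m i := by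
  rw [startCount]
  split_ifs
  · exact Nat.mul_pos (by positivity) (by omega)
  · exact one_pos

lemma sum_startCount {m : ℕ} (hm : m < K) {d : ℕ} (hd : d ≤ m) :
    ∑ i ∈ tailSet K d, startCount K m i = 2 ^ (m - d) * (K - m) := by
  induction hd using Nat.decreasingInduction with
  | self =>
    rw [Finset.sum_congr rfl fun i hi => ?_, Finset.sum_const, card_tailSet, smul_eq_mul, mul_one,
      Nat.sub_self, pow_zero, one_mul]
    rw [startCount, if_neg (by rw [mem_tailSet] at hi; omega)]
  | of_succ d hd ih =>
    rw [← Finset.add_sum_erase _ _ (mem_tailSet.2 (le_refl d) : (⟨d, by omega⟩ : Fin K) ∈ _),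
      tailSet_erase, ih, startCount, if_pos hd, show m - d = m - 1 - d + 1 by omega, pow_succ,
      show m - (d + 1) = m - 1 - d by omega]
    ring

variable [NeZero K]

/-- The family of the sets `tailSet K d` with `d ≤ m`. -/
def IsTail (K m : ℕ) (S : Finset (Fin K)) : Prop := ∃ d ≤ m, S = tailSet K d

/-- Two orderings play the same experts until `d` experts have died. -/
def SamePast (d : ℕ) (π ρ : PermExpert K) : Prop :=
  ∀ k ≤ d, firstAlive (tailSet K k) π = firstAlive (tailSet K k) ρ

noncomputable instance (d : ℕ) (π ρ : PermExpert K) : Decidable (SamePast d π ρ) :=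
  Classical.propDecidable _

lemma SamePast.symm {d : ℕ} {π ρ : PermExpert K} (h : SamePast d π ρ) : SamePast d ρ π :=
  fun k hk => (h k hk).symm

lemma SamePast.trans {d : ℕ} {π ρ τ : PermExpert K} (h : SamePast d π ρ) (h' : SamePast d ρ τ) :
    SamePast d π τ := fun k hk => (h k hk).trans (h' k hk)

lemma samePast_succ {d : ℕ} {π ρ : PermExpert K} : SamePast (d + 1) π ρ ↔
    SamePast d π ρ ∧ firstAlive (tailSet K (d + 1)) π = firstAlive (tailSet K (d + 1)) ρ := by
  simp only [SamePast, Nat.le_succ_iff]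
  constructor
  · exact fun h => ⟨fun k hk => h k (Or.inl hk), h _ (Or.inr rfl)⟩
  · rintro ⟨h, h'⟩ k (hk | rfl)
    exacts [h k hk, h']

/-- Any continuation is possible for an ordering that plays the dying expert `d`. -/
lemma exists_samePast {d : ℕ} (hd : d < K) {π : PermExpert K}
    (hπ : firstAlive (tailSet K d) π = ⟨d, hd⟩) {i : Fin K} (hi : i ∈ tailSet K (d + 1)) :
    ∃ π', SamePast d π π' ∧ firstAlive (tailSet K (d + 1)) π' = i := by
  have hmem := firstAlive_mem ⟨i, hi⟩ π
  refine ⟨π.trans (Equiv.swap i (firstAlive (tailSet K (d + 1)) π)), fun k hk => ?_, ?_⟩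
  · refine (firstAlive_trans_swap_of_subset hπ ?_ ?_ (tailSet_anti hk)).symm <;>
      rwa [tailSet_erase]
  · rw [firstAlive_trans_swap hi hmem, Equiv.swap_apply_right]

variable {m : ℕ} {A : Finset (PermExpert K)}

lemma card_continuation {d : ℕ} (hd : d < K)
    (hcount : ∀ π, (A.filter fun ρ => SamePast (d + 1) π ρ).card =
      startCount K m (firstAlive (tailSet K (d + 1)) π)) {π : PermExpert K}
    (hπ : firstAlive (tailSet K d) π = ⟨d, hd⟩) {i : Fin K} (hi : i ∈ tailSet K (d + 1)) :
    (A.filter fun ρ => SamePast d π ρ ∧ firstAlive (tailSet K (d + 1)) ρ = i).card =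
      startCount K m i := by
  obtain ⟨π', hπ', hi'⟩ := exists_samePast hd hπ hi
  rw [← hi', ← hcount π']
  congr 1
  refine Finset.filter_congr fun ρ _ => ?_
  rw [samePast_succ, eq_comm (a := firstAlive (tailSet K (d + 1)) ρ)]
  exact and_congr_left fun _ => ⟨hπ'.symm.trans, hπ'.trans⟩

/-- Whatever happened before, `startCount K m i` behaviors continue a past that ends with playing
expert `i`. -/
lemma card_samePast (hm : m < K) (hA : ∀ π, ∃! ρ, ρ ∈ A ∧ SamePast m π ρ) {d : ℕ} (hd : d ≤ m)
    (π : PermExpert K) : (A.filter fun ρ => SamePast d π ρ).card =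
      startCount K m (firstAlive (tailSet K d) π) := by
  induction hd using Nat.decreasingInduction generalizing π with
  | self =>
    have hmem := firstAlive_mem (tailSet_nonempty hm) π
    rw [mem_tailSet] at hmem
    rw [startCount, if_neg (by omega), Finset.card_eq_one]
    obtain ⟨ρ, hρ, huniq⟩ := hA π
    refine ⟨ρ, Finset.eq_singleton_iff_unique_mem.2 ⟨Finset.mem_filter.2 hρ, fun τ hτ => ?_⟩⟩
    exact huniq τ (Finset.mem_filter.1 hτ)
  | of_succ d hd ih =>
    have hdK : d < K := hd.trans hm
    have hne : (tailSet K (d + 1)).Nonempty := tailSet_nonempty (by omega)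
    by_cases hπ : firstAlive (tailSet K d) π = ⟨d, hdK⟩
    · rw [Finset.card_eq_sum_card_fiberwise (f := firstAlive (tailSet K (d + 1)))
        (t := tailSet K (d + 1)) fun ρ _ => firstAlive_mem hne ρ]
      simp only [Finset.filter_filter]
      rw [Finset.sum_congr rfl fun i hi => card_continuation hdK ih hπ hi,
        sum_startCount hm hd, hπ, startCount, if_pos hd, Nat.sub_sub, Nat.add_comm 1 d]
    · have hstay : ∀ ρ, firstAlive (tailSet K d) ρ = firstAlive (tailSet K d) π →
          firstAlive (tailSet K (d + 1)) ρ = firstAlive (tailSet K d) π := by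
        intro ρ hρ
        rw [← tailSet_erase hdK, firstAlive_erase_eq_iff]
        · exact Or.inl hρ
        · exact Finset.mem_erase.2 ⟨hπ, firstAlive_mem (tailSet_nonempty hdK) π⟩
      rw [← hstay π rfl, ← ih]
      congr 1
      refine Finset.filter_congr fun ρ _ => ?_
      rw [samePast_succ]
      refine ⟨fun h => ⟨h, ?_⟩, And.left⟩
      rw [hstay π rfl, hstay ρ (h d le_rfl).symm]

/-- The orderings that play a dying expert move to the remaining experts in proportion to the
numbers of their continuations. -/
theorem splits_hpk (hm : m < K) (hA : ∀ π, ∃! ρ, ρ ∈ A ∧ SamePast m π ρ) :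
    Splits (hpk K m) A (IsTail K m) where
  init_eq i := by
    have hu := Finset.mem_univ (α := Fin K)
    let π : PermExpert K := (Equiv.refl _).trans (Equiv.swap i (firstAlive Finset.univ 1))
    have hπ : firstAlive Finset.univ π = i :=
      (firstAlive_trans_swap (hu _) (hu _)).trans (Equiv.swap_apply_right _ _)
    have h := card_samePast hm hA (Nat.zero_le m) π
    rw [tailSet_zero, hπ] at h
    simp only [hpk]
    rw [← h]
    congr 2
    refine Finset.filter_congr fun ρ _ => ?_
    simp only [SamePast, Nat.le_zero, forall_eq, tailSet_zero, hπ]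
    exact eq_comm
  init_pos i := by
    simp only [hpk]
    exact_mod_cast startCount_pos hm i
  share_pos E j i _ _ _ _ := by
    have hi := startCount_pos hm i
    have hj := startCount_pos hm j
    simp only [hpk]
    positivity
  split E j i F hE hj hE' hi hF := by
    obtain ⟨d, hd, rfl⟩ := hE
    obtain ⟨d', hd', hdd'⟩ := hE'
    have hlt : d < d' := by
      by_contra h
      have : j ∈ tailSet K d' := tailSet_anti (not_lt.1 h) hj
      rw [← hdd'] at this
      exact Finset.ne_of_mem_erase this rfl
    have hdK : d < K := by omega
    have hjd : j = ⟨d, hdK⟩ := by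
      by_contra h
      have : (⟨d, hdK⟩ : Fin K) ∈ (tailSet K d).erase j :=
        Finset.mem_erase.2 ⟨Ne.symm h, mem_tailSet.2 le_rfl⟩
      rw [hdd', mem_tailSet] at this
      exact absurd this (not_le.2 hlt)
    subst hjd
    rw [tailSet_erase hdK] at hi ⊢
    -- count the pairs of orderings with the same past in which the first one moves to `i`
    have hdouble : ∑ π ∈ A with firstAlive (tailSet K d) π = ⟨d, hdK⟩ ∧
          firstAlive (tailSet K (d + 1)) π = i, ∑ ρ ∈ A with SamePast d π ρ, F ρ =
        ∑ ρ ∈ A with firstAlive (tailSet K d) ρ = ⟨d, hdK⟩,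
          ∑ π ∈ A with SamePast d ρ π ∧ firstAlive (tailSet K (d + 1)) π = i, F ρ := by
      refine Finset.sum_comm' fun π ρ => ?_
      simp only [Finset.mem_filter]
      constructor
      · rintro ⟨⟨hπ, h1, h2⟩, hρ, h3⟩
        exact ⟨⟨hπ, h3.symm, h2⟩, hρ, (h3 d le_rfl).symm.trans h1⟩
      · rintro ⟨⟨hπ, h1, h2⟩, hρ, h3⟩
        exact ⟨⟨hπ, (h1 d le_rfl).symm.trans h3, h2⟩, hρ, h1.symm⟩
    have hleft : ∑ π ∈ A with firstAlive (tailSet K d) π = ⟨d, hdK⟩ ∧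
          firstAlive (tailSet K (d + 1)) π = i, ∑ ρ ∈ A with SamePast d π ρ, F ρ =
        ∑ π ∈ A with firstAlive (tailSet K d) π = ⟨d, hdK⟩ ∧
          firstAlive (tailSet K (d + 1)) π = i, startCount K m ⟨d, hdK⟩ * F π := by
      refine Finset.sum_congr rfl fun π hπ => ?_
      rw [← (Finset.mem_filter.1 hπ).2.1, ← card_samePast hm hA hd π, ← nsmul_eq_mul,
        ← Finset.sum_const]
      refine Finset.sum_congr rfl fun ρ hρ => hF _ _ ?_
      rintro S ⟨k, -, rfl⟩ hS
      have hk : k ≤ d := mem_tailSet.1 (hS (mem_tailSet.2 (le_refl d) : (⟨d, hdK⟩ : Fin K) ∈ _))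
      exact ((Finset.mem_filter.1 hρ).2 k hk).symm
    have hright : ∑ ρ ∈ A with firstAlive (tailSet K d) ρ = ⟨d, hdK⟩,
          ∑ π ∈ A with SamePast d ρ π ∧ firstAlive (tailSet K (d + 1)) π = i, F ρ =
        ∑ ρ ∈ A with firstAlive (tailSet K d) ρ = ⟨d, hdK⟩, startCount K m i * F ρ := by
      refine Finset.sum_congr rfl fun ρ hρ => ?_
      rw [Finset.sum_const, nsmul_eq_mul,
        card_continuation hdK (card_samePast hm hA (by omega)) (Finset.mem_filter.1 hρ).2 hi]
    rw [hdouble, hright, ← Finset.mul_sum, ← Finset.mul_sum] at hleft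
    have hpos : (startCount K m ⟨d, hdK⟩ : ℝ) ≠ 0 := by
      exact_mod_cast (startCount_pos hm _).ne'
    simp only [hpk]
    rw [div_mul_eq_mul_div, hleft, mul_div_cancel_left₀ _ hpos]

end Known

/-! ### Games in which the experts die in the order of their indices -/

namespace Game

variable {K T : ℕ} {G : Game K T}

/-- Deaths are processed in the order of the indices, so the sets of alive experts in the dummy
rounds are up-closed as well. -/
lemma sdiff_take_deaths_upper (ho : G.DiesInOrder) {t : ℕ} (ht : 1 ≤ t) (htT : t < T) (k : ℕ)
    {i j : Fin K} (hij : i < j) (hi : i ∈ G.alive t \ ((G.deaths t).take k).toFinset) :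
    j ∈ G.alive t \ ((G.deaths t).take k).toFinset := by
  simp only [Finset.mem_sdiff, List.mem_toFinset] at hi ⊢
  refine ⟨ho t ht htT.le i j hij hi.1, fun hj => ?_⟩
  have hjd := mem_deaths.1 (List.mem_of_mem_take hj)
  have hid : i ∈ G.deaths t :=
    mem_deaths.2 ⟨hi.1, fun h => hjd.2 (ho (t + 1) (by omega) htT i j hij h)⟩
  have hsort := (G.alive t \ G.alive (t + 1)).pairwise_sort (· ≤ ·)
  change (G.deaths t).Pairwise _ at hsort
  rw [← List.take_append_drop k (G.deaths t)] at hid hsort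
  have hdrop := (List.mem_append.1 hid).resolve_left hi.2
  exact absurd ((List.pairwise_append.1 hsort).2.2 j hj i hdrop) (not_le.2 hij)

lemma alive_eq_tailSet (ho : G.DiesInOrder) {t : ℕ} (ht : 1 ≤ t) (htT : t ≤ T) :
    G.alive t = tailSet K (K - (G.alive t).card) :=
  eq_tailSet fun i j hij hi => ho t ht htT i j hij hi

lemma within_isTail (ho : G.DiesInOrder) : G.Within (IsTail K G.numDeaths) where
  alive t ht htT := ⟨_, Nat.sub_le_sub_left
    (Finset.card_le_card (G.alive_subset ht htT le_rfl)) K, alive_eq_tailSet ho ht htT⟩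
  dummy t ht htT k _ := by
    refine ⟨_, ?_, eq_tailSet fun i j hij hi => sdiff_take_deaths_upper ho ht htT k hij hi⟩
    refine Nat.sub_le_sub_left (Finset.card_le_card ?_) K
    refine (G.alive_subset (s := t + 1) (by omega) htT le_rfl).trans fun i hi => ?_
    rw [Finset.mem_sdiff, List.mem_toFinset]
    exact ⟨G.alive_anti t ht htT hi, fun h => (mem_deaths.1 (List.mem_of_mem_take h)).2 hi⟩

/-- Every `tailSet K d` with `d ≤ G.numDeaths` is the set of alive experts in some round or dummy round. -/
lemma exists_eq_tailSet (ho : G.DiesInOrder) (hT : 1 ≤ T) {d : ℕ} (hd : d ≤ G.numDeaths) :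
    ∃ t, 1 ≤ t ∧ t ≤ T ∧ (G.alive t = tailSet K d ∨ t < T ∧ ∃ k, 1 ≤ k ∧
      k < (G.deaths t).length ∧ G.alive t \ ((G.deaths t).take k).toFinset = tailSet K d) := by
  -- the last round in which all of `tailSet K d` is alive
  let p : ℕ → Prop := fun t => 1 ≤ t ∧ tailSet K d ⊆ G.alive t
  have hp1 : p 1 := ⟨le_rfl, by rw [G.alive_one]; exact Finset.subset_univ _⟩
  classical
  obtain ⟨ht1, hsub⟩ : p (Nat.findGreatest p T) := Nat.findGreatest_spec hT hp1
  have htT : Nat.findGreatest p T ≤ T := Nat.findGreatest_le T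
  have hmax : ∀ t', Nat.findGreatest p T < t' → t' ≤ T → ¬ p t' := fun t' h h' =>
    Nat.findGreatest_is_greatest h h'
  generalize Nat.findGreatest p T = t at *
  refine ⟨t, ht1, htT, ?_⟩
  rcases htT.eq_or_lt with rfl | htT'
  · left
    refine Finset.Subset.antisymm ?_ hsub
    rw [alive_eq_tailSet ho ht1 le_rfl]
    exact tailSet_anti hd
  · have ha := alive_eq_tailSet ho ht1 htT
    have hb := alive_eq_tailSet ho (t := t + 1) (by omega) htT'
    have hcardK : (G.alive t).card ≤ K := by simpa using (G.alive t).card_le_univ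
    have hdcard : K - d ≤ (G.alive t).card := by
      rw [← card_tailSet]
      exact Finset.card_le_card hsub
    have hdb : (G.alive (t + 1)).card < K - d := by
      by_contra h
      refine hmax (t + 1) (by omega) htT' ⟨by omega, ?_⟩
      rw [hb]
      exact tailSet_anti (by omega)
    have hlen : (G.deaths t).length = (G.alive t).card - (G.alive (t + 1)).card := by
      rw [Game.deaths, Finset.length_sort, Finset.card_sdiff_of_subset (G.alive_anti t ht1 htT')]
    rcases hdcard.eq_or_lt with heq | hlt
    · left
      rw [ha, ← heq]
      congr 1
      omega
    · right
      refine ⟨htT', (G.alive t).card - (K - d), by omega, by omega, ?_⟩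
      have hk := eq_tailSet fun i j hij hi =>
        sdiff_take_deaths_upper ho ht1 htT' ((G.alive t).card - (K - d)) (i := i) (j := j) hij hi
      rw [hk, Finset.card_sdiff_of_subset, List.toFinset_card_of_nodup, List.length_take, hlen]
      · congr 1
        omega
      · exact (Finset.sort_nodup _ _).sublist (List.take_sublist _ _)
      · intro i hi
        rw [List.mem_toFinset] at hi
        exact (mem_deaths.1 (List.mem_of_mem_take hi)).1

variable [NeZero K]

lemma sameBehavior_iff_samePast (ho : G.DiesInOrder) (hT : 1 ≤ T) {π ρ : PermExpert K} :
    G.SameBehavior π ρ ↔ SamePast G.numDeaths π ρ := by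
  have hw := within_isTail ho
  constructor
  · rintro ⟨h, h'⟩ d hd
    obtain ⟨t, ht, htT, heq | ⟨htT', k, hk, hk', heq⟩⟩ := exists_eq_tailSet ho hT hd
    · rw [← heq]
      exact h t ht htT
    · rw [← heq]
      exact h' t ht htT' k hk hk'
  · refine fun h => ⟨fun t ht htT => ?_, fun t ht htT k _ hk => ?_⟩
    · obtain ⟨d, hd, heq⟩ := hw.alive t ht htT
      rw [Game.sigma, Game.sigma, heq]
      exact h d hd
    · obtain ⟨d, hd, heq⟩ := hw.dummy t ht htT k hk.le
      rw [heq]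
      exact h d hd

lemma numDeaths_lt (hT : 1 ≤ T) : G.numDeaths < K := by
  have := (G.alive_nonempty T hT le_rfl).card_pos
  have := NeZero.pos K
  rw [Game.numDeaths]
  omega

end Game

lemma Splits.le_card {K : ℕ} [NeZero K] {R : Rule K} {A : Finset (PermExpert K)}
    {fam : Finset (Fin K) → Prop} (hR : Splits R A fam) : K ≤ A.card := by
  rw [Finset.card_eq_sum_card_fiberwise (f := firstAlive Finset.univ) (t := Finset.univ)
    fun _ _ => Finset.mem_coe.2 (Finset.mem_univ _)]
  have h : ∀ i ∈ (Finset.univ : Finset (Fin K)),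
      1 ≤ (A.filter fun π => firstAlive Finset.univ π = i).card := fun i _ => by
    have := hR.init_pos i
    rw [hR.init_eq] at this
    exact_mod_cast this
  simpa using Finset.card_nsmul_le_sum _ _ 1 h

end DyingExperts
theorem corollary1 (α φ : ℝ) (hα : 0 < α) (hφ : 1 < φ) :
    ∃ C₀ C₁ C₂ C₃ : ℝ, 0 < C₀ ∧ 0 < C₁ ∧ 0 < C₂ ∧ 0 < C₃ ∧
      ∀ (K T : ℕ) [NeZero K] (G : Game K T), 2 ≤ K → 1 ≤ T →
        (G.Simulates (hpu K) α φ Finset.univ ∧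
          ∀ n, 1 ≤ n → n ≤ T →
            G.algRegret (hpu K) α φ Finset.univ n < G.bound C₀ C₁ C₂ C₃ Finset.univ n) ∧
        (G.DiesInOrder → ∀ A : Finset (PermExpert K), G.IsEffective A →
          G.Simulates (hpk K G.numDeaths) α φ A ∧
          ∀ n, 1 ≤ n → n ≤ T →
            G.algRegret (hpk K G.numDeaths) α φ A n < G.bound C₀ C₁ C₂ C₃ A n) := by
  obtain ⟨C₀, C₁, C₂, C₃, h₀, h₁, h₂, h₃, hbound⟩ := exists_flipFlop_regret_lt hα hφ
  refine ⟨C₀, C₁, C₂, C₃, h₀, h₁, h₂, h₃, fun K T _ G hK hT => ?_⟩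
  have main : ∀ {R : Rule K} {A : Finset (PermExpert K)} {fam : Finset (Fin K) → Prop},
      Splits R A fam → G.Within fam → G.Simulates R α φ A ∧ ∀ n, 1 ≤ n → n ≤ T →
        G.algRegret R α φ A n < G.bound C₀ C₁ C₂ C₃ A n := by
    intro R A fam hR hG
    refine ⟨Game.simulates hR hG α φ, fun n hn hnT => ?_⟩
    rw [Game.algRegret_eq hR hG α φ hnT]
    exact hbound A G.permLoss n (hK.trans hR.le_card) hn
      fun t ht htn π _ => G.loss_mem t ht (htn.trans hnT) _
  refine ⟨main splits_hpu ⟨fun _ _ _ => trivial, fun _ _ _ _ _ => trivial⟩, fun ho A hA => ?_⟩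
  refine main (splits_hpk (Game.numDeaths_lt hT) fun π => ?_) (Game.within_isTail ho)
  simpa only [Game.sameBehavior_iff_samePast ho hT] using hA π
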